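/- **Conventions.** A *finitary generalized algebraic theory* (GAT) $T$ consists of small sets of sort symbols $(x_1:A_1,\dots,x_n:A_n)\vdash S(x_1,\dots,x_n)\ \mathrm{type}$, operation symbols $(x_1:A_1,\dots,x_n:A_n)\vdash c(x_1,\dots,x_n):A$, and equations $(x_1:A_1,\dots,x_n:A_n)\vdash s=t:A$ between terms, all contexts being finite and all of this data being well-formed, i.e. derivable by the usual rules of dependent type theory. $\mathrm{Alg}_T$ is the category of models of $T$ in sets: sort symbols are interpreted by families of sets over the interpretations of their contexts, operation symbols by dependent functions satisfying the equations, and morphisms are families of maps compatible with the operations. A *unary operation* on a sort symbol $S$ with context $x_1:A_1,\dots,x_n:A_n$ is an operation $o$ with context $x_1:A_1,\dots,x_n:A_n,\ y:S(x_1,\dots,x_n)$; its main input is $y$, and we write $o(y)$. A *unary equation* on $S$ is an equation in this context. An *interpretation* of $T$ is a GAT of the form $T'=(T,O,E,E')$ where: 1. $O$ is a set of unary operations. For each $o\in O$ on $S$, the type of $o(y)$ is given by a type of $T$ depending on $y$, on the $x_i$, and on variables standing for the $o'(y)$ and $o'(x_i)$ with $o'\in O$. So, for every context $\Gamma$ of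 $T$, there is a context $\Gamma^D$ of $T$ consisting of the variables $x$ of $\Gamma$ together with a variable for each $o(x)$, where $x$ is a variable of $\Gamma$ and $o\in O$ is an operation on the sort symbol of $x$. 2. $O$ is defined recursively by $E$: the set $E$ consists of one equation $$o(c(x_1,\dots,x_n))=c^{o}\bigl(x_i,\,o'(x_i)\bigr)$$ for each operation symbol $c$ of $T$, with context $\Gamma_c$, and each $o\in O$ on the sort symbol of its values. Here $c^{o}$ is a term of $T$ in the context $\Gamma_c^D$, of the type required of $o(c(x_1,\dots,x_n))$. By means of these equations $o(t)$ can be computed, for every term $t$ of $T$ in a context $\Gamma$, as a term $t^{o}$ of $T$ in the context $\Gamma^D$. It is required that for each equation $s=t$ of $T$ in a context $\Gamma$, and each $o\in O$ on its sort symbol, $s^{o}=t^{o}$ is derivable in $T$ in the context $\Gamma^D$. 3. $E'$ is a set of unary equations between terms of $(T,O)$ that are proved inductively: for each operation symbol $c$ of $T$, the equations of $E'$ on the sort symbol of its values, instantiated at $c(x_1,\dots,x_n)$, are derivable in $(T,O,E)$ in the context of $c$ from the equations of $E'$ instantiated at the variables $x_1,\dots,x_n$. **Theorem.** Let $T$ be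 a finitary generalized algebraic theory and $T'$ an interpretation of $T$. Then the forgetful functor $$U:\mathrm{Alg}_{T'}\to\mathrm{Alg}_T$$ has a right adjoint. -/

import Mathlib

open CategoryTheory

universe u

/-! ### Raw syntax of generalized algebraic theories -/

/-- The symbols of a generalized algebraic theory, with the head sorts of their arguments.
`Par S R` is the set of those parameters of the sort symbol `S` whose type has head `R`, and
`Arg f R` is the set of those arguments of the operation symbol `f` whose type has head `R`.
Variables are named rather than numbered; each symbol has finitely many of them. -/
structure Sig where
  Srt : Type u
  Par : Srt → Srt → Type u
  Op : Type u
  res : Op → Srt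
  Arg : Op → Srt → Type u
  finPar : ∀ S, Finite (Σ R, Par S R)
  finArg : ∀ f, Finite (Σ R, Arg f R)

namespace Sig

/-- Raw terms in variables `X`, indexed by the head sort of their type. -/
inductive Tm (G : Sig.{u}) (X : G.Srt → Type u) : G.Srt → Type u
  | var {S : G.Srt} (x : X S) : Tm G X S
  | op (f : G.Op) (a : ∀ R, G.Arg f R → Tm G X R) : Tm G X (G.res f)

/-- Raw types with head `S`: the type `S(t₁, …, tₙ)` is given by the terms `tᵢ`, one for each
parameter of `S`. -/
abbrev Ty (G : Sig.{u}) (X : G.Srt → Type u) (S : G.Srt) : Type u :=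
  ∀ R, G.Par S R → G.Tm X R

/-- Raw contexts with variables `X`: a raw type for each variable. The order of a telescope is not
recorded; the typing rule for variables forces the dependencies to be well founded. -/
abbrev Ctx (G : Sig.{u}) (X : G.Srt → Type u) : Type u :=
  ∀ S, X S → G.Ty X S

/-- Simultaneous substitutions, replacing the variables `X` by terms in the variables `Y`. -/
abbrev Sub (G : Sig.{u}) (X Y : G.Srt → Type u) : Type u :=
  ∀ S, X S → G.Tm Y S

variable {G : Sig.{u}} {X Y : G.Srt → Type u}

def Tm.subst (σ : G.Sub X Y) : ∀ {S : G.Srt}, G.Tm X S → G.Tm Y S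
  | _, .var x => σ _ x
  | _, .op f a => .op f (fun R i => (a R i).subst σ)

def Ty.subst (σ : G.Sub X Y) {S : G.Srt} (A : G.Ty X S) : G.Ty Y S :=
  fun R j => (A R j).subst σ

/-- The identity substitution. -/
def idSub (G : Sig.{u}) (X : G.Srt → Type u) : G.Sub X X :=
  fun _ x => .var x

/-- Sets of equations between terms in the variables `X`, used as additional hypotheses. -/
abbrev Hyps (G : Sig.{u}) (X : G.Srt → Type u) : Type u :=
  ∀ S, G.Tm X S → G.Tm X S → Prop

/-- The empty set of additional hypotheses. -/
def noHyps (G : Sig.{u}) (X : G.Srt → Type u) : G.Hyps X :=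
  fun _ _ _ => False

end Sig

/-- The raw data of a generalized algebraic theory:
sort symbols `(parCtx S) ⊢ S type`, operation symbols `(argCtx f) ⊢ f : resTy f`, and
equations `(eqCtx e) ⊢ lhs e = rhs e : eqTy e`. All contexts are finite. -/
structure PreGAT extends Sig.{u} where
  parCtx : ∀ S, toSig.Ctx (Par S)
  argCtx : ∀ f, toSig.Ctx (Arg f)
  resTy : ∀ f, toSig.Ty (Arg f) (res f)
  Eqn : Type u
  EqVar : Eqn → Srt → Type u
  finEqVar : ∀ e, Finite (Σ R, EqVar e R)
  eqCtx : ∀ e, toSig.Ctx (EqVar e)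
  eqSrt : Eqn → Srt
  eqTy : ∀ e, toSig.Ty (EqVar e) (eqSrt e)
  lhs : ∀ e, toSig.Tm (EqVar e) (eqSrt e)
  rhs : ∀ e, toSig.Tm (EqVar e) (eqSrt e)

namespace PreGAT

/-! ### Derivations

The four judgements `Γ ⊢ A type`, `Γ ⊢ t : A`, `Γ ⊢ A = B` and `Γ ⊢ t = t' : A`, under additional
equational hypotheses `H`. The rule of a symbol or of an equation can be used only when its own
premises have been derived (without additional hypotheses). -/

mutual

inductive IsTy (T : PreGAT.{u}) : ∀ {X : T.Srt → Type u}, T.Ctx X → T.Hyps X →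
    ∀ {S : T.Srt}, T.Ty X S → Prop
  | sort {X : T.Srt → Type u} {Γ : T.Ctx X} {H : T.Hyps X} {S : T.Srt} (A : T.Ty X S)
      (wfPar : ∀ R (j : T.Par S R), IsTy T (T.parCtx S) (T.noHyps _) (T.parCtx S R j))
      (hA : ∀ R (j : T.Par S R), HasTy T Γ H (A R j) ((T.parCtx S R j).subst A)) :
      IsTy T Γ H A

inductive HasTy (T : PreGAT.{u}) : ∀ {X : T.Srt → Type u}, T.Ctx X → T.Hyps X →
    ∀ {S : T.Srt}, T.Tm X S → T.Ty X S → Prop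
  | var {X : T.Srt → Type u} {Γ : T.Ctx X} {H : T.Hyps X} {S : T.Srt} (x : X S)
      (hx : IsTy T Γ H (Γ S x)) :
      HasTy T Γ H (.var x) (Γ S x)
  | op {X : T.Srt → Type u} {Γ : T.Ctx X} {H : T.Hyps X} (f : T.Op) (a : T.Sub (T.Arg f) X)
      (wfArg : ∀ R (i : T.Arg f R), IsTy T (T.argCtx f) (T.noHyps _) (T.argCtx f R i))
      (wfRes : IsTy T (T.argCtx f) (T.noHyps _) (T.resTy f))
      (ha : ∀ R (i : T.Arg f R), HasTy T Γ H (a R i) ((T.argCtx f R i).subst a)) :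
      HasTy T Γ H (.op f a) ((T.resTy f).subst a)
  | conv {X : T.Srt → Type u} {Γ : T.Ctx X} {H : T.Hyps X} {S : T.Srt} {t : T.Tm X S}
      {A B : T.Ty X S} (ht : HasTy T Γ H t A) (hAB : EqTy T Γ H A B) :
      HasTy T Γ H t B

inductive EqTy (T : PreGAT.{u}) : ∀ {X : T.Srt → Type u}, T.Ctx X → T.Hyps X →
    ∀ {S : T.Srt}, T.Ty X S → T.Ty X S → Prop
  | refl {X : T.Srt → Type u} {Γ : T.Ctx X} {H : T.Hyps X} {S : T.Srt} {A : T.Ty X S}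
      (hA : IsTy T Γ H A) : EqTy T Γ H A A
  | symm {X : T.Srt → Type u} {Γ : T.Ctx X} {H : T.Hyps X} {S : T.Srt} {A B : T.Ty X S}
      (hAB : EqTy T Γ H A B) : EqTy T Γ H B A
  | trans {X : T.Srt → Type u} {Γ : T.Ctx X} {H : T.Hyps X} {S : T.Srt} {A B C : T.Ty X S}
      (hAB : EqTy T Γ H A B) (hBC : EqTy T Γ H B C) : EqTy T Γ H A C
  | sort {X : T.Srt → Type u} {Γ : T.Ctx X} {H : T.Hyps X} {S : T.Srt} {A B : T.Ty X S}
      (hA : IsTy T Γ H A) (hB : IsTy T Γ H B)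
      (hAB : ∀ R (j : T.Par S R), EqTm T Γ H (A R j) (B R j) ((T.parCtx S R j).subst A)) :
      EqTy T Γ H A B

inductive EqTm (T : PreGAT.{u}) : ∀ {X : T.Srt → Type u}, T.Ctx X → T.Hyps X →
    ∀ {S : T.Srt}, T.Tm X S → T.Tm X S → T.Ty X S → Prop
  | refl {X : T.Srt → Type u} {Γ : T.Ctx X} {H : T.Hyps X} {S : T.Srt} {t : T.Tm X S}
      {A : T.Ty X S} (ht : HasTy T Γ H t A) : EqTm T Γ H t t A
  | symm {X : T.Srt → Type u} {Γ : T.Ctx X} {H : T.Hyps X} {S : T.Srt} {t t₁ : T.Tm X S}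
      {A : T.Ty X S} (h : EqTm T Γ H t t₁ A) : EqTm T Γ H t₁ t A
  | trans {X : T.Srt → Type u} {Γ : T.Ctx X} {H : T.Hyps X} {S : T.Srt} {t t₁ t₂ : T.Tm X S}
      {A : T.Ty X S} (h : EqTm T Γ H t t₁ A) (h₁ : EqTm T Γ H t₁ t₂ A) : EqTm T Γ H t t₂ A
  | conv {X : T.Srt → Type u} {Γ : T.Ctx X} {H : T.Hyps X} {S : T.Srt} {t t₁ : T.Tm X S}
      {A B : T.Ty X S} (h : EqTm T Γ H t t₁ A) (hAB : EqTy T Γ H A B) : EqTm T Γ H t t₁ B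
  | congr {X : T.Srt → Type u} {Γ : T.Ctx X} {H : T.Hyps X} (f : T.Op)
      (a b : T.Sub (T.Arg f) X)
      (ha : HasTy T Γ H (.op f a) ((T.resTy f).subst a))
      (hb : HasTy T Γ H (.op f b) ((T.resTy f).subst b))
      (hab : ∀ R (i : T.Arg f R), EqTm T Γ H (a R i) (b R i) ((T.argCtx f R i).subst a)) :
      EqTm T Γ H (.op f a) (.op f b) ((T.resTy f).subst a)
  | ax {X : T.Srt → Type u} {Γ : T.Ctx X} {H : T.Hyps X} (e : T.Eqn) (a : T.Sub (T.EqVar e) X)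
      (wfCtx : ∀ R (i : T.EqVar e R), IsTy T (T.eqCtx e) (T.noHyps _) (T.eqCtx e R i))
      (wfLhs : HasTy T (T.eqCtx e) (T.noHyps _) (T.lhs e) (T.eqTy e))
      (wfRhs : HasTy T (T.eqCtx e) (T.noHyps _) (T.rhs e) (T.eqTy e))
      (ha : ∀ R (i : T.EqVar e R), HasTy T Γ H (a R i) ((T.eqCtx e R i).subst a)) :
      EqTm T Γ H ((T.lhs e).subst a) ((T.rhs e).subst a) ((T.eqTy e).subst a)
  | hyp {X : T.Srt → Type u} {Γ : T.Ctx X} {H : T.Hyps X} {S : T.Srt} {t t₁ : T.Tm X S}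
      {A : T.Ty X S} (h : H S t t₁) (ht : HasTy T Γ H t A) (ht₁ : HasTy T Γ H t₁ A) :
      EqTm T Γ H t t₁ A

end

/-- All sort symbols, operation symbols and equations of the theory have derivable premises. -/
structure WellFormed (T : PreGAT.{u}) : Prop where
  par : ∀ S R (j : T.Par S R), T.IsTy (T.parCtx S) (T.noHyps _) (T.parCtx S R j)
  arg : ∀ f R (i : T.Arg f R), T.IsTy (T.argCtx f) (T.noHyps _) (T.argCtx f R i)
  res : ∀ f, T.IsTy (T.argCtx f) (T.noHyps _) (T.resTy f)
  eqVar : ∀ e R (i : T.EqVar e R), T.IsTy (T.eqCtx e) (T.noHyps _) (T.eqCtx e R i)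
  lhs : ∀ e, T.HasTy (T.eqCtx e) (T.noHyps _) (T.lhs e) (T.eqTy e)
  rhs : ∀ e, T.HasTy (T.eqCtx e) (T.noHyps _) (T.rhs e) (T.eqTy e)

end PreGAT

/-- A finitary generalized algebraic theory. -/
structure GAT extends PreGAT.{u} where
  wf : toPreGAT.WellFormed

/-! ### Models -/

/-- A structure for a signature. The family of sets interpreting a sort symbol `S` is given by its
total set `El S`, with `idx x` the tuple of parameters of `x : El S`; so the set `S(a)` is
`{x : El S | idx x = a}`. An operation symbol is interpreted by (the graph of) a partial
function. -/
structure Sig.Str (G : Sig.{u}) where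
  El : G.Srt → Type u
  idx : ∀ {S : G.Srt}, El S → ∀ R, G.Par S R → El R
  app : ∀ f : G.Op, (∀ R, G.Arg f R → El R) → El (G.res f) → Prop

namespace Sig.Str

variable {G : Sig.{u}} (M : G.Str) {X : G.Srt → Type u}

/-- `M.Eval ρ t u`: the term `t` is defined in the environment `ρ` and its value is `u`. -/
def Eval (ρ : ∀ S, X S → M.El S) : ∀ {S : G.Srt}, G.Tm X S → M.El S → Prop
  | _, .var x, u => ρ _ x = u
  | _, .op f a, u => ∃ b : ∀ R, G.Arg f R → M.El R, (∀ R i, Eval ρ (a R i) (b R i)) ∧ M.app f b u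

/-- `u` is an element of the interpretation of the type `A` in the environment `ρ`. -/
def IsElem (ρ : ∀ S, X S → M.El S) {S : G.Srt} (A : G.Ty X S) (u : M.El S) : Prop :=
  ∀ R (j : G.Par S R), M.Eval ρ (A R j) (M.idx u R j)

/-- The environment `ρ` is an element of the interpretation of the context `Γ`. -/
def IsEnv (Γ : G.Ctx X) (ρ : ∀ S, X S → M.El S) : Prop :=
  ∀ S (x : X S), M.IsElem ρ (Γ S x) (ρ S x)

end Sig.Str

/-- `M` is a model of the theory `T`. -/
structure PreGAT.IsModel (T : PreGAT.{u}) (M : T.Str) : Prop where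
  /-- the sort symbol `S` is interpreted by a family over the interpretation of its context -/
  idx_env : ∀ {S : T.Srt} (x : M.El S), M.IsEnv (T.parCtx S) (M.idx x)
  /-- operations are functions, defined exactly on the interpretation of their context -/
  app_unique : ∀ (f : T.Op) (a : ∀ R, T.Arg f R → M.El R) (u v : M.El (T.res f)),
    M.app f a u → M.app f a v → u = v
  app_iff : ∀ (f : T.Op) (a : ∀ R, T.Arg f R → M.El R),
    (∃ u, M.app f a u) ↔ M.IsEnv (T.argCtx f) a
  /-- the values of operations are in the right set -/
  app_elem : ∀ (f : T.Op) (a : ∀ R, T.Arg f R → M.El R) (u : M.El (T.res f)),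
    M.app f a u → M.IsElem a (T.resTy f) u
  /-- the equations hold -/
  eqn : ∀ (e : T.Eqn) (ρ : ∀ R, T.EqVar e R → M.El R), M.IsEnv (T.eqCtx e) ρ →
    ∃ u, M.Eval ρ (T.lhs e) u ∧ M.Eval ρ (T.rhs e) u

/-- The models of the theory `T` in sets. -/
structure PreGAT.Alg (T : PreGAT.{u}) where
  str : T.Str
  isModel : T.IsModel str

namespace PreGAT.Alg

variable {T : PreGAT.{u}}

/-- Morphisms of models: families of maps respecting the parameters and the operations. -/
@[ext]
structure Hom (M N : T.Alg) where
  map : ∀ S, M.str.El S → N.str.El S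
  map_idx : ∀ {S : T.Srt} (x : M.str.El S) (R) (j : T.Par S R),
    map R (M.str.idx x R j) = N.str.idx (map S x) R j
  map_app : ∀ (f : T.Op) (a : ∀ R, T.Arg f R → M.str.El R) (u : M.str.El (T.res f)),
    M.str.app f a u → N.str.app f (fun R i => map R (a R i)) (map _ u)

instance : Category T.Alg where
  Hom := Hom
  id M := ⟨fun _ x => x, fun _ _ _ => rfl, fun _ _ _ h => h⟩
  comp g h := ⟨fun S x => h.map S (g.map S x),
    fun x R j => by rw [g.map_idx, h.map_idx],
    fun f a u hu => h.map_app f _ _ (g.map_app f a u hu)⟩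

end PreGAT.Alg

/-! ### Extensions by unary operations -/

/-- The variables of a unary operation (or equation) on the sort symbol `S`: the main variable, and
the parameters of `S`, which can be inferred from it. -/
inductive UVar {Srt : Type u} (Par : Srt → Srt → Type u) (S : Srt) : Srt → Type u
  | par {R : Srt} (j : Par S R) : UVar Par S R
  | main : UVar Par S S

theorem UVar.finite {Srt : Type u} {Par : Srt → Srt → Type u} (S : Srt)
    (h : Finite (Σ R, Par S R)) : Finite (Σ R, UVar Par S R) := by
  refine Finite.of_surjective (α := Option (Σ R, Par S R))
    (fun | none => ⟨S, .main⟩ | some p => ⟨p.1, .par p.2⟩) ?_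
  rintro ⟨R, _ | _⟩
  · exact ⟨some ⟨R, _⟩, rfl⟩
  · exact ⟨none, rfl⟩

/-- Given a set `O S` of unary operations on each sort symbol `S`, with values in `out S o`:
for variables `X`, the variables `x` together with variables standing for `o(x)`, for each
unary operation `o` that applies to `x`. -/
inductive DVar {Srt : Type u} (O : Srt → Type u) (out : ∀ S, O S → Srt) (X : Srt → Type u) :
    Srt → Type u
  | base {S : Srt} (x : X S) : DVar O out X S
  | star {S : Srt} (o : O S) (x : X S) : DVar O out X (out S o)

def DVar.elim {Srt : Type u} {O : Srt → Type u} {out : ∀ S, O S → Srt} {X Z : Srt → Type u}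
    (f : ∀ S, X S → Z S) (g : ∀ S (o : O S), X S → Z (out S o)) : ∀ S, DVar O out X S → Z S
  | _, .base x => f _ x
  | _, .star o x => g _ o x

namespace Sig

variable {G : Sig.{u}}

/-- The signature `G` with additional unary operation symbols `O`. -/
@[reducible]
def addOps (G : Sig.{u}) (O : G.Srt → Type u) (out : ∀ S, O S → G.Srt) : Sig.{u} where
  Srt := G.Srt
  Par := G.Par
  Op := G.Op ⊕ (Σ S, O S)
  res
    | .inl f => G.res f
    | .inr p => out p.1 p.2
  Arg
    | .inl f => G.Arg f
    | .inr p => UVar G.Par p.1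
  finPar := G.finPar
  finArg
    | .inl f => G.finArg f
    | .inr p => UVar.finite p.1 (G.finPar p.1)

/-- Terms of `G` are terms of the extended signature. -/
def Tm.lift {O : G.Srt → Type u} {out : ∀ S, O S → G.Srt} {X : G.Srt → Type u} :
    ∀ {S : G.Srt}, G.Tm X S → (G.addOps O out).Tm X S
  | _, .var x => .var (G := G.addOps O out) x
  | _, .op f a => .op (G := G.addOps O out) (.inl f) (fun R i => (a R i).lift)

def Ty.lift {O : G.Srt → Type u} {out : ∀ S, O S → G.Srt} {X : G.Srt → Type u} {S : G.Srt}
    (A : G.Ty X S) : (G.addOps O out).Ty X S :=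
  fun R j => (A R j).lift

def Ctx.lift {O : G.Srt → Type u} {out : ∀ S, O S → G.Srt} {X : G.Srt → Type u}
    (Γ : G.Ctx X) : (G.addOps O out).Ctx X :=
  fun S x => (Γ S x).lift

/-- The substitution of a term `t : A`, with `A` of head `S`, for the main variable of a unary
operation on `S`, and of the parameters of `A` for the other variables. -/
def unarySub {X : G.Srt → Type u} {S : G.Srt} (A : G.Ty X S) (t : G.Tm X S) :
    G.Sub (UVar G.Par S) X
  | _, .par j => A _ j
  | _, .main => t

end Sig

/-- The context `x₁ : A₁, …, xₙ : Aₙ, y : S(x₁, …, xₙ)` of a unary operation on `S`, where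
`x₁ : A₁, …, xₙ : Aₙ` is the context of the sort symbol `S`. -/
def PreGAT.unaryCtx (T : PreGAT.{u}) (S : T.Srt) : T.Ctx (UVar T.Par S)
  | _, .par j => (T.parCtx S _ j).subst (fun _ i => .var (.par i))
  | _, .main => fun _ j => .var (.par j)

/-- The raw data of an extension `T, O, E, E'` of `T` by unary operations `O`, recursive equations
`E` and unary equations `E'`.

* `O S` is the set of unary operations on the sort symbol `S`; the operation `o : O S` has values
  in the type `cod o`. This is a type of `T` depending on the main input `y`, its parameters `xᵢ`,
  and on the `o'(y)` and `o'(xᵢ)`.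
* `E` consists of the equations `o(c(x₁, …, xₙ)) = recTm c o`, for each operation symbol `c`
  of `T` and each `o` that applies to its values, where `recTm c o` is a term of `T` depending on
  the `xᵢ` and on the `o'(xᵢ)`.
* `Eqs S` is the set of the equations `lhs e = rhs e : eqTy e` in `E'` whose main variable is in
  the sort `S`; these are equations between terms in which the operations in `O` may occur. -/
structure UnaryExt (T : PreGAT.{u}) where
  O : T.Srt → Type u
  out : ∀ S, O S → T.Srt
  cod : ∀ {S : T.Srt} (o : O S), T.Ty (DVar O out (UVar T.Par S)) (out S o)
  recTm : ∀ (c : T.Op) (o : O (T.res c)), T.Tm (DVar O out (T.Arg c)) (out _ o)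
  Eqs : T.Srt → Type u
  eqSrt : ∀ {S : T.Srt}, Eqs S → T.Srt
  eqTy : ∀ {S : T.Srt} (e : Eqs S), (T.addOps O out).Ty (UVar T.Par S) (eqSrt e)
  lhs : ∀ {S : T.Srt} (e : Eqs S), (T.addOps O out).Tm (UVar T.Par S) (eqSrt e)
  rhs : ∀ {S : T.Srt} (e : Eqs S), (T.addOps O out).Tm (UVar T.Par S) (eqSrt e)

namespace UnaryExt

variable {T : PreGAT.{u}} (I : UnaryExt T) {X Y : T.Srt → Type u}

/-- The signature of `T` with the additional operations. -/
abbrev sig : Sig.{u} := T.addOps I.O I.out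

/-- The variables `x` and `o(x)`. -/
abbrev D (X : T.Srt → Type u) : T.Srt → Type u := DVar I.O I.out X

/-- For a term `t` of `T` and a unary operation `o`, the term of `T` obtained by computing `o(t)`
with the recursive equations, down to the `o'(x)` for the variables `x`. -/
def star : ∀ {S : T.Srt}, T.Tm X S → ∀ o : I.O S, T.Tm (I.D X) (I.out S o)
  | _, .var x => fun o => .var (.star o x)
  | _, .op c a => fun o => (I.recTm c o).subst
      (DVar.elim (Z := T.Tm (I.D X)) (fun _ i => (a _ i).subst (fun _ x => .var (.base x)))
        (fun _ o₁ i => star (a _ i) o₁))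

/-- The action of a substitution `σ` on the variables `x` and `o(x)`. -/
def dSub (σ : T.Sub X Y) : T.Sub (I.D X) (I.D Y) :=
  DVar.elim (Z := T.Tm (I.D Y)) (fun _ x => (σ _ x).subst (fun _ y => .var (.base y)))
    (fun _ o x => I.star (σ _ x) o)

/-- The type of `o(t)`, for `t : A`, as a type of `T`. -/
def starTy {S : T.Srt} (o : I.O S) (A : T.Ty X S) (t : T.Tm X S) : T.Ty (I.D X) (I.out S o) :=
  (I.cod o).subst (I.dSub (Sig.unarySub A t))

/-- The context of `T` consisting of the variables `x : A` of `Γ`, and of variables for the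
`o(x)`. -/
def dCtx (Γ : T.Ctx X) : T.Ctx (I.D X)
  | _, .base x => (Γ _ x).subst (fun _ y => .var (.base y))
  | _, .star o x => I.starTy o (Γ _ x) (.var x)

/-- The application of the operation symbol `o` to a term `t : A`. -/
def appTm {S : T.Srt} (o : I.O S) (A : I.sig.Ty X S) (t : I.sig.Tm X S) :
    I.sig.Tm X (I.out S o) :=
  .op (G := I.sig) (.inr ⟨S, o⟩) (Sig.unarySub (G := I.sig) A t)

/-- The substitution of the actual terms `o(x)` for the variables standing for them. -/
def unstar (Γ : T.Ctx X) : I.sig.Sub (I.D X) X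
  | _, .base x => .var (G := I.sig) x
  | _, .star o x => I.appTm o (Γ _ x).lift (.var (G := I.sig) x)

/-- The theory `T, O, E`. -/
def recGAT : PreGAT.{u} where
  toSig := I.sig
  parCtx S := (T.parCtx S).lift
  argCtx
    | .inl c => (T.argCtx c).lift
    | .inr p => (T.unaryCtx p.1).lift
  resTy
    | .inl c => (T.resTy c).lift
    | .inr p => Sig.Ty.subst (G := I.sig) (I.unstar (T.unaryCtx p.1)) (I.cod p.2).lift
  Eqn := T.Eqn ⊕ (Σ c : T.Op, I.O (T.res c))
  EqVar
    | .inl e => T.EqVar e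
    | .inr p => T.Arg p.1
  finEqVar
    | .inl e => T.finEqVar e
    | .inr p => T.finArg p.1
  eqCtx
    | .inl e => (T.eqCtx e).lift
    | .inr p => (T.argCtx p.1).lift
  eqSrt
    | .inl e => T.eqSrt e
    | .inr p => I.out _ p.2
  eqTy
    | .inl e => (T.eqTy e).lift
    | .inr p => Sig.Ty.subst (G := I.sig) (I.unstar (T.argCtx p.1))
        (I.starTy p.2 (T.resTy p.1) (.op p.1 (T.idSub _))).lift
  lhs
    | .inl e => (T.lhs e).lift
    | .inr p => I.appTm p.2 (T.resTy p.1).lift (Sig.Tm.op p.1 (T.idSub _)).lift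
  rhs
    | .inl e => (T.rhs e).lift
    | .inr p => Sig.Tm.subst (G := I.sig) (I.unstar (T.argCtx p.1)) (I.recTm p.1 p.2).lift

/-- The theory `T, O, E, E'`. -/
def extGAT : PreGAT.{u} where
  toSig := I.sig
  parCtx := I.recGAT.parCtx
  argCtx := I.recGAT.argCtx
  resTy := I.recGAT.resTy
  Eqn := I.recGAT.Eqn ⊕ (Σ S, I.Eqs S)
  EqVar
    | .inl e => I.recGAT.EqVar e
    | .inr p => UVar T.Par p.1
  finEqVar
    | .inl e => I.recGAT.finEqVar e
    | .inr p => UVar.finite p.1 (T.finPar p.1)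
  eqCtx
    | .inl e => I.recGAT.eqCtx e
    | .inr p => (T.unaryCtx p.1).lift
  eqSrt
    | .inl e => I.recGAT.eqSrt e
    | .inr p => I.eqSrt p.2
  eqTy
    | .inl e => I.recGAT.eqTy e
    | .inr p => I.eqTy p.2
  lhs
    | .inl e => I.recGAT.lhs e
    | .inr p => I.lhs p.2
  rhs
    | .inl e => I.recGAT.rhs e
    | .inr p => I.rhs p.2

/-- The induction hypotheses for the operation symbol `c`: the equations in `E'`, for each argument
`x` of `c`. -/
inductive IndHyps (c : T.Op) : I.sig.Hyps (T.Arg c)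
  | mk {S : T.Srt} (x : T.Arg c S) (e : I.Eqs S) :
      IndHyps c (I.eqSrt e)
        (Sig.Tm.subst (G := I.sig)
          (Sig.unarySub (G := I.sig) (T.argCtx c S x).lift (.var (G := I.sig) x)) (I.lhs e))
        (Sig.Tm.subst (G := I.sig)
          (Sig.unarySub (G := I.sig) (T.argCtx c S x).lift (.var (G := I.sig) x)) (I.rhs e))

/-- The substitution of `c(x₁, …, xₙ)` for the main variable of a unary equation. -/
def conSub (c : T.Op) : I.sig.Sub (UVar T.Par (T.res c)) (T.Arg c) :=
  Sig.unarySub (G := I.sig) (T.resTy c).lift (Sig.Tm.op c (T.idSub _)).lift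

end UnaryExt

/-- An interpretation of the finitary generalized algebraic theory `T`: a generalized algebraic
theory `T, O, E, E'` where `O` is a set of unary operations defined recursively by `E`, and `E'` is
a set of unary equations proved inductively. -/
structure Interpretation (T : GAT.{u}) extends UnaryExt T.toPreGAT where
  /-- `T, O, E, E'` is a generalized algebraic theory -/
  wf : toUnaryExt.extGAT.WellFormed
  /-- the type of `o(y)` is a type of `T`, in the context of the `y`, `xᵢ`, `o'(y)`, `o'(xᵢ)` -/
  isTy_cod : ∀ {S : T.Srt} (o : O S),
    T.IsTy (toUnaryExt.dCtx (T.unaryCtx S)) (T.noHyps _) (cod o)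
  /-- `recTm c o` is a term of `T`, in the context of the `xᵢ`, `o'(xᵢ)`, of the type required
  of `o(c(x₁, …, xₙ))` -/
  hasTy_rec : ∀ (c : T.Op) (o : O (T.res c)),
    T.HasTy (toUnaryExt.dCtx (T.argCtx c)) (T.noHyps _) (recTm c o)
      (toUnaryExt.starTy o (T.resTy c) (.op c (T.idSub _)))
  /-- for each equation `s = t` of `T`, the equation `o(s) = o(t)`, with both sides computed
  by the recursive equations, is derivable in `T` -/
  star_eq : ∀ (e : T.Eqn) (o : O (T.eqSrt e)),
    T.EqTm (toUnaryExt.dCtx (T.eqCtx e)) (T.noHyps _)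
      (toUnaryExt.star (T.lhs e) o) (toUnaryExt.star (T.rhs e) o)
      (toUnaryExt.starTy o (T.eqTy e) (T.lhs e))
  /-- for each operation symbol `c` of `T`, the equations in `E'` are derivable in `T, O, E`
  for `c(x₁, …, xₙ)` from the equations in `E'` for `x₁, …, xₙ` -/
  induct : ∀ (c : T.Op) (e : Eqs (T.res c)),
    toUnaryExt.recGAT.EqTm (X := T.Arg c) (T.argCtx c).lift (toUnaryExt.IndHyps c)
      (Sig.Tm.subst (G := toUnaryExt.sig) (toUnaryExt.conSub c) (lhs e))
      (Sig.Tm.subst (G := toUnaryExt.sig) (toUnaryExt.conSub c) (rhs e))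
      (Sig.Ty.subst (G := toUnaryExt.sig) (toUnaryExt.conSub c) (eqTy e))

/-- The theory `T, O, E, E'`. -/
def Interpretation.toGAT {T : GAT.{u}} (I : Interpretation T) : GAT.{u} :=
  ⟨I.extGAT, I.wf⟩

/-! ### The forgetful functor -/

/-- The underlying structure for the smaller signature. -/
def Sig.Str.reduct {G : Sig.{u}} {O : G.Srt → Type u} {out : ∀ S, O S → G.Srt}
    (M : (G.addOps O out).Str) : G.Str where
  El := M.El
  idx := M.idx
  app f := M.app (.inl f)

theorem Sig.Str.eval_lift {G : Sig.{u}} {O : G.Srt → Type u} {out : ∀ S, O S → G.Srt}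
    (M : (G.addOps O out).Str) {X : G.Srt → Type u} (ρ : ∀ S, X S → M.El S) {S : G.Srt}
    (t : G.Tm X S) : ∀ u, M.Eval ρ t.lift u ↔ M.reduct.Eval ρ t u := by
  induction t with
  | var x => exact fun u => Iff.rfl
  | op f a ih =>
    intro u
    constructor
    · rintro ⟨b, hb, hu⟩
      exact ⟨b, fun R i => (ih R i _).1 (hb R i), hu⟩
    · rintro ⟨b, hb, hu⟩
      exact ⟨b, fun R i => (ih R i _).2 (hb R i), hu⟩

theorem Sig.Str.isElem_lift {G : Sig.{u}} {O : G.Srt → Type u} {out : ∀ S, O S → G.Srt}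
    (M : (G.addOps O out).Str) {X : G.Srt → Type u} (ρ : ∀ S, X S → M.El S) {S : G.Srt}
    (A : G.Ty X S) (u : M.El S) : M.IsElem ρ A.lift u ↔ M.reduct.IsElem ρ A u :=
  forall_congr' fun R => forall_congr' fun j => M.eval_lift ρ (A R j) _

theorem Sig.Str.isEnv_lift {G : Sig.{u}} {O : G.Srt → Type u} {out : ∀ S, O S → G.Srt}
    (M : (G.addOps O out).Str) {X : G.Srt → Type u} (Γ : G.Ctx X) (ρ : ∀ S, X S → M.El S) :
    M.IsEnv Γ.lift ρ ↔ M.reduct.IsEnv Γ ρ :=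
  forall_congr' fun S => forall_congr' fun x => M.isElem_lift ρ (Γ S x) _

theorem UnaryExt.isModel_reduct {T : PreGAT.{u}} (I : UnaryExt T) (M : I.sig.Str)
    (h : I.extGAT.IsModel M) : T.IsModel M.reduct where
  idx_env x := (M.isEnv_lift _ _).1 (h.idx_env x)
  app_unique f := h.app_unique (.inl f)
  app_iff f a := (h.app_iff (.inl f) a).trans (M.isEnv_lift _ _)
  app_elem f a u hu := (M.isElem_lift _ _ _).1 (h.app_elem (.inl f) a u hu)
  eqn e ρ hρ := by
    obtain ⟨u, h₁, h₂⟩ := h.eqn (.inl (.inl e)) ρ ((M.isEnv_lift _ _).2 hρ)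
    exact ⟨u, (M.eval_lift _ _ _).1 h₁, (M.eval_lift _ _ _).1 h₂⟩

/-- The forgetful functor from the models of `T, O, E, E'` to the models of `T`. -/
def Interpretation.forget {T : GAT.{u}} (I : Interpretation T) : I.toGAT.Alg ⥤ T.Alg where
  obj M := ⟨Sig.Str.reduct M.str, I.isModel_reduct M.str M.isModel⟩
  map h := ⟨h.map, h.map_idx, fun f => h.map_app (.inl f)⟩

namespace Sig

variable {G : Sig.{u}} {X Y Z : G.Srt → Type u}

theorem Tm.subst_subst (σ : G.Sub X Y) (τ : G.Sub Y Z) {S : G.Srt} (t : G.Tm X S) :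
    (t.subst σ).subst τ = t.subst (fun _ x => (σ _ x).subst τ) := by
  induction t with
  | var x => rfl
  | op f a ih => simp only [Tm.subst, ih]

theorem Tm.subst_id {S : G.Srt} (t : G.Tm X S) : t.subst (G.idSub X) = t := by
  induction t with
  | var x => rfl
  | op f a ih => simp only [Tm.subst, ih]

theorem Ty.subst_subst (σ : G.Sub X Y) (τ : G.Sub Y Z) {S : G.Srt} (A : G.Ty X S) :
    (A.subst σ).subst τ = A.subst (fun _ x => (σ _ x).subst τ) :=
  funext fun _ => funext fun _ => Tm.subst_subst _ _ _

theorem Ty.subst_id {S : G.Srt} (A : G.Ty X S) : A.subst (G.idSub X) = A :=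
  funext fun _ => funext fun _ => Tm.subst_id _

namespace Str

variable (M : G.Str)

/-- The values of the terms of the substitution `σ` in the environment `ρ` form the
environment `v`. -/
def EvalSub (ρ : ∀ S, Y S → M.El S) (σ : G.Sub X Y) (v : ∀ S, X S → M.El S) : Prop :=
  ∀ S x, M.Eval ρ (σ S x) (v S x)

/-- Operations have at most one value. -/
def Functional : Prop :=
  ∀ (f : G.Op) (a : ∀ R, G.Arg f R → M.El R) (u v : M.El (G.res f)),
    M.app f a u → M.app f a v → u = v

variable {M}

theorem Eval.unique (hM : M.Functional) {ρ : ∀ S, X S → M.El S} {S : G.Srt} {t : G.Tm X S} :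
    ∀ {u v : M.El S}, M.Eval ρ t u → M.Eval ρ t v → u = v := by
  induction t with
  | var x => exact fun h h' => h.symm.trans h'
  | op f a ih =>
    rintro u v ⟨b, hb, hu⟩ ⟨b', hb', hv⟩
    obtain rfl : b = b' := funext fun R => funext fun i => ih R i (hb R i) (hb' R i)
    exact hM f b u v hu hv

theorem EvalSub.unique (hM : M.Functional) {ρ : ∀ S, Y S → M.El S} {σ : G.Sub X Y}
    {v w : ∀ S, X S → M.El S} (h : M.EvalSub ρ σ v) (h' : M.EvalSub ρ σ w) : v = w :=
  funext fun _ => funext fun _ => (h _ _).unique hM (h' _ _)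

theorem eval_subst (hM : M.Functional) {ρ : ∀ S, Y S → M.El S} {σ : G.Sub X Y}
    {v : ∀ S, X S → M.El S} (h : M.EvalSub ρ σ v) {S : G.Srt} (t : G.Tm X S) :
    ∀ u, M.Eval ρ (t.subst σ) u ↔ M.Eval v t u := by
  induction t with
  | var x => exact fun u => ⟨fun hu => (h _ x).unique hM hu, fun hu => hu ▸ h _ x⟩
  | op f a ih =>
    exact fun u => exists_congr fun b => and_congr_left fun _ =>
      forall_congr' fun R => forall_congr' fun i => ih R i _

theorem evalSub_subst (hM : M.Functional) {ρ : ∀ S, Z S → M.El S} {σ : G.Sub Y Z}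
    {v : ∀ S, Y S → M.El S} (h : M.EvalSub ρ σ v) (τ : G.Sub X Y) (w : ∀ S, X S → M.El S) :
    M.EvalSub ρ (fun _ x => (τ _ x).subst σ) w ↔ M.EvalSub v τ w :=
  forall_congr' fun _ => forall_congr' fun _ => eval_subst hM h _ _

theorem isElem_subst (hM : M.Functional) {ρ : ∀ S, Y S → M.El S} {σ : G.Sub X Y}
    {v : ∀ S, X S → M.El S} (h : M.EvalSub ρ σ v) {S : G.Srt} (A : G.Ty X S) (u : M.El S) :
    M.IsElem ρ (A.subst σ) u ↔ M.IsElem v A u :=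
  forall_congr' fun _ => forall_congr' fun _ => eval_subst hM h _ _

/-- Terms evaluate to elements of any set closed under the operations. -/
theorem Eval.closed {P : ∀ S, M.El S → Prop}
    (hP : ∀ f a u, (∀ R i, P R (a R i)) → M.app f a u → P _ u) {ρ : ∀ S, X S → M.El S}
    (hρ : ∀ S x, P S (ρ S x)) {S : G.Srt} {t : G.Tm X S} :
    ∀ {u : M.El S}, M.Eval ρ t u → P S u := by
  induction t with
  | var x => rintro _ rfl; exact hρ _ x
  | op f a ih =>
    rintro u ⟨b, hb, hu⟩
    exact hP f b u (fun R i => ih R i (hb R i)) hu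

/-- Maps respecting the operations respect the values of terms. -/
theorem Eval.map {N : G.Str} (g : ∀ S, M.El S → N.El S)
    (hg : ∀ f a u, M.app f a u → N.app f (fun R i => g R (a R i)) (g _ u))
    {ρ : ∀ S, X S → M.El S} {S : G.Srt} {t : G.Tm X S} :
    ∀ {u : M.El S}, M.Eval ρ t u → N.Eval (fun _ x => g _ (ρ _ x)) t (g _ u) := by
  induction t with
  | var x => rintro _ rfl; rfl
  | op f a ih =>
    rintro u ⟨b, hb, hu⟩
    exact ⟨_, fun R i => ih R i (hb R i), hg f b u hu⟩

theorem IsElem.map {N : G.Str} (g : ∀ S, M.El S → N.El S)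
    (hg : ∀ f a u, M.app f a u → N.app f (fun R i => g R (a R i)) (g _ u))
    (hidx : ∀ S (x : M.El S) R (j : G.Par S R), g R (M.idx x R j) = N.idx (g S x) R j)
    {ρ : ∀ S, X S → M.El S} {S : G.Srt} {A : G.Ty X S} {u : M.El S} (h : M.IsElem ρ A u) :
    N.IsElem (fun _ x => g _ (ρ _ x)) A (g _ u) :=
  fun R j => hidx _ u R j ▸ (h R j).map g hg

/-! ### Substructures -/

/-- The substructure on a set of elements closed under taking parameters. -/
def sub (M : G.Str) (P : ∀ S, M.El S → Prop)
    (hP : ∀ S x, P S x → ∀ R (j : G.Par S R), P R (M.idx x R j)) : G.Str where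
  El S := {x : M.El S // P S x}
  idx x R j := ⟨M.idx x.1 R j, hP _ _ x.2 R j⟩
  app f a u := M.app f (fun R i => (a R i).1) u.1

theorem eval_sub {P : ∀ S, M.El S → Prop}
    (hP : ∀ S x, P S x → ∀ R (j : G.Par S R), P R (M.idx x R j))
    (hP' : ∀ f a u, (∀ R i, P R (a R i)) → M.app f a u → P _ u)
    (ρ : ∀ S, X S → (M.sub P hP).El S) {S : G.Srt} (t : G.Tm X S) :
    ∀ u, (M.sub P hP).Eval ρ t u ↔ M.Eval (fun _ x => (ρ _ x).1) t u.1 := by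
  induction t with
  | var x => exact fun u => Subtype.ext_iff
  | op f a ih =>
    intro u
    constructor
    · rintro ⟨b, hb, hu⟩
      exact ⟨_, fun R i => (ih R i _).1 (hb R i), hu⟩
    · rintro ⟨b, hb, hu⟩
      exact ⟨fun R i => ⟨b R i, (hb R i).closed hP' fun S x => (ρ S x).2⟩,
        fun R i => (ih R i _).2 (hb R i), hu⟩

/-! ### Products -/

/-- The product of a family of structures. -/
def pi {ι : Type} (M : ι → G.Str) : G.Str where
  El S := ∀ n, (M n).El S
  idx x R j n := (M n).idx (x n) R j
  app f a u := ∀ n, (M n).app f (fun R i => a R i n) (u n)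

theorem eval_pi {ι : Type} {M : ι → G.Str} (ρ : ∀ S, X S → (pi M).El S) {S : G.Srt}
    (t : G.Tm X S) :
    ∀ u, (pi M).Eval ρ t u ↔ ∀ n, (M n).Eval (fun _ x => ρ _ x n) t (u n) := by
  induction t with
  | var x => exact fun u => funext_iff
  | op f a ih =>
    intro u
    constructor
    · rintro ⟨b, hb, hu⟩ n
      exact ⟨_, fun R i => (ih R i _).1 (hb R i) n, hu n⟩
    · intro h
      choose b hb hu using h
      exact ⟨fun R i n => b n R i, fun R i => (ih R i _).2 fun n => hb n R i, hu⟩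

end Str

end Sig

namespace PreGAT

variable {T : PreGAT.{u}}

theorem IsModel.functional {M : T.Str} (hM : T.IsModel M) : M.Functional :=
  hM.app_unique

theorem IsModel.sub {M : T.Str} (hM : T.IsModel M) {P : ∀ S, M.El S → Prop}
    (hP : ∀ S x, P S x → ∀ R (j : T.Par S R), P R (M.idx x R j))
    (hP' : ∀ f a u, (∀ R i, P R (a R i)) → M.app f a u → P _ u) :
    T.IsModel (M.sub P hP) := by
  have hElem {X : T.Srt → Type u} (ρ : ∀ S, X S → (M.sub P hP).El S) {S : T.Srt} (A : T.Ty X S)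
      (u) : (M.sub P hP).IsElem ρ A u ↔ M.IsElem (fun _ x => (ρ _ x).1) A u.1 :=
    forall_congr' fun R => forall_congr' fun j => Sig.Str.eval_sub hP hP' _ _ _
  have hEnv {X : T.Srt → Type u} (Γ : T.Ctx X) (ρ : ∀ S, X S → (M.sub P hP).El S) :
      (M.sub P hP).IsEnv Γ ρ ↔ M.IsEnv Γ (fun _ x => (ρ _ x).1) :=
    forall_congr' fun S => forall_congr' fun x => hElem _ _ _
  constructor
  · exact fun x => (hEnv _ _).2 (hM.idx_env x.1)
  · exact fun f a u v hu hv => Subtype.ext (hM.app_unique f _ _ _ hu hv)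
  · intro f a
    rw [hEnv, ← hM.app_iff]
    exact ⟨fun ⟨u, hu⟩ => ⟨u.1, hu⟩, fun ⟨u, hu⟩ => ⟨⟨u, hP' f _ u (fun R i => (a R i).2) hu⟩, hu⟩⟩
  · exact fun f a u hu => (hElem _ _ _).2 (hM.app_elem f _ _ hu)
  · intro e ρ hρ
    obtain ⟨u, h, h'⟩ := hM.eqn e _ ((hEnv _ _).1 hρ)
    exact ⟨⟨u, h.closed hP' fun S x => (ρ S x).2⟩,
      (Sig.Str.eval_sub hP hP' _ _ _).2 h, (Sig.Str.eval_sub hP hP' _ _ _).2 h'⟩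

theorem IsModel.pi {ι : Type} {M : ι → T.Str} (hM : ∀ n, T.IsModel (M n)) :
    T.IsModel (Sig.Str.pi M) := by
  have hElem {X : T.Srt → Type u} (ρ : ∀ S, X S → (Sig.Str.pi M).El S) {S : T.Srt} (A : T.Ty X S)
      (u) : (Sig.Str.pi M).IsElem ρ A u ↔ ∀ n, (M n).IsElem (fun _ x => ρ _ x n) A (u n) :=
    ⟨fun h n R j => (Sig.Str.eval_pi _ _ _).1 (h R j) n,
      fun h R j => (Sig.Str.eval_pi _ _ _).2 fun n => h n R j⟩
  have hEnv {X : T.Srt → Type u} (Γ : T.Ctx X) (ρ : ∀ S, X S → (Sig.Str.pi M).El S) :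
      (Sig.Str.pi M).IsEnv Γ ρ ↔ ∀ n, (M n).IsEnv Γ (fun _ x => ρ _ x n) :=
    ⟨fun h n S x => (hElem _ _ _).1 (h S x) n, fun h S x => (hElem _ _ _).2 fun n => h n S x⟩
  constructor
  · exact fun x => (hEnv _ _).2 fun n => (hM n).idx_env (x n)
  · exact fun f a u v hu hv => funext fun n => (hM n).app_unique f _ _ _ (hu n) (hv n)
  · intro f a
    rw [hEnv]
    simp only [← (hM _).app_iff]
    exact ⟨fun ⟨u, hu⟩ n => ⟨u n, hu n⟩, fun h => ⟨fun n => (h n).choose, fun n => (h n).choose_spec⟩⟩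
  · exact fun f a u hu => (hElem _ _ _).2 fun n => (hM n).app_elem f _ _ (hu n)
  · intro e ρ hρ
    choose u h h' using fun n => (hM n).eqn e _ ((hEnv _ _).1 hρ n)
    exact ⟨u, (Sig.Str.eval_pi _ _ _).2 h, (Sig.Str.eval_pi _ _ _).2 h'⟩

/-! ### Soundness -/

/-- The additional hypotheses hold in the environment `ρ`. -/
def Holds (M : T.Str) {X : T.Srt → Type u} (H : T.Hyps X) (ρ : ∀ S, X S → M.El S) : Prop :=
  ∀ S t t₁, H S t t₁ → ∃ u, M.Eval ρ t u ∧ M.Eval ρ t₁ u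

theorem holds_noHyps (M : T.Str) {X : T.Srt → Type u} (ρ : ∀ S, X S → M.El S) :
    Holds M (T.noHyps X) ρ :=
  fun _ _ _ h => h.elim

mutual

theorem HasTy.sound {M : T.Str} (hM : T.IsModel M) : ∀ {X : T.Srt → Type u} {Γ : T.Ctx X}
    {H : T.Hyps X} {S : T.Srt} {t : T.Tm X S} {A : T.Ty X S}, T.HasTy Γ H t A →
    ∀ ρ, M.IsEnv Γ ρ → Holds M H ρ → ∃ u, M.Eval ρ t u ∧ M.IsElem ρ A u
  | _, Γ, _, S, _, .(Γ S x), .var x _, ρ, hρ, _ => ⟨ρ _ x, rfl, hρ _ x⟩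
  | _, _, _, _, _, _, .op f a _ _ ha, ρ, hρ, hH => by
    choose b hb using fun R i => (ha R i).sound hM ρ hρ hH
    have hab : M.EvalSub ρ a b := fun R i => (hb R i).1
    obtain ⟨u, hu⟩ := (hM.app_iff f b).2 fun R i =>
      (Sig.Str.isElem_subst hM.functional hab _ _).1 (hb R i).2
    exact ⟨u, ⟨b, hab, hu⟩, (Sig.Str.isElem_subst hM.functional hab _ _).2 (hM.app_elem f b u hu)⟩
  | _, _, _, _, _, _, .conv ht hAB, ρ, hρ, hH => by
    obtain ⟨u, hu, hA⟩ := ht.sound hM ρ hρ hH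
    exact ⟨u, hu, (hAB.sound hM ρ hρ hH _).1 hA⟩

theorem EqTy.sound {M : T.Str} (hM : T.IsModel M) : ∀ {X : T.Srt → Type u} {Γ : T.Ctx X}
    {H : T.Hyps X} {S : T.Srt} {A B : T.Ty X S}, T.EqTy Γ H A B →
    ∀ ρ, M.IsEnv Γ ρ → Holds M H ρ → ∀ v, M.EvalSub ρ A v ↔ M.EvalSub ρ B v
  | _, _, _, _, _, _, .refl _, _, _, _ => fun _ => Iff.rfl
  | _, _, _, _, _, _, .symm h, ρ, hρ, hH => fun v => (h.sound hM ρ hρ hH v).symm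
  | _, _, _, _, _, _, .trans h h', ρ, hρ, hH => fun v =>
    (h.sound hM ρ hρ hH v).trans (h'.sound hM ρ hρ hH v)
  | _, _, _, _, _, _, .sort _ _ hAB, ρ, hρ, hH => fun v =>
    forall_congr' fun R => forall_congr' fun j => by
      obtain ⟨u, hu, hu', _⟩ := (hAB R j).sound hM ρ hρ hH
      constructor <;> intro h
      · exact hu.unique hM.functional h ▸ hu'
      · exact hu'.unique hM.functional h ▸ hu

theorem EqTm.sound {M : T.Str} (hM : T.IsModel M) : ∀ {X : T.Srt → Type u} {Γ : T.Ctx X}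
    {H : T.Hyps X} {S : T.Srt} {t t₁ : T.Tm X S} {A : T.Ty X S}, T.EqTm Γ H t t₁ A →
    ∀ ρ, M.IsEnv Γ ρ → Holds M H ρ → ∃ u, M.Eval ρ t u ∧ M.Eval ρ t₁ u ∧ M.IsElem ρ A u
  | _, _, _, _, _, _, _, .refl ht, ρ, hρ, hH => by
    obtain ⟨u, hu, hA⟩ := ht.sound hM ρ hρ hH
    exact ⟨u, hu, hu, hA⟩
  | _, _, _, _, _, _, _, .symm h, ρ, hρ, hH => by
    obtain ⟨u, hu, hu', hA⟩ := h.sound hM ρ hρ hH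
    exact ⟨u, hu', hu, hA⟩
  | _, _, _, _, _, _, _, .trans h h₁, ρ, hρ, hH => by
    obtain ⟨u, hu, hu', hA⟩ := h.sound hM ρ hρ hH
    obtain ⟨v, hv, hv', -⟩ := h₁.sound hM ρ hρ hH
    exact ⟨u, hu, hu'.unique hM.functional hv ▸ hv', hA⟩
  | _, _, _, _, _, _, _, .conv h hAB, ρ, hρ, hH => by
    obtain ⟨u, hu, hu', hA⟩ := h.sound hM ρ hρ hH
    exact ⟨u, hu, hu', (hAB.sound hM ρ hρ hH _).1 hA⟩
  | _, _, _, _, _, _, _, .congr f a b ha _ hab, ρ, hρ, hH => by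
    obtain ⟨u, ⟨d, hd, hu⟩, hA⟩ := ha.sound hM ρ hρ hH
    refine ⟨u, ⟨d, hd, hu⟩, ⟨d, fun R i => ?_, hu⟩, hA⟩
    obtain ⟨v, hv, hv', -⟩ := (hab R i).sound hM ρ hρ hH
    exact (hd R i).unique hM.functional hv ▸ hv'
  | _, _, _, _, _, _, _, .ax e a _ wfLhs _ ha, ρ, hρ, hH => by
    choose b hb using fun R i => (ha R i).sound hM ρ hρ hH
    have hab : M.EvalSub ρ a b := fun R i => (hb R i).1
    have hb' : M.IsEnv (T.eqCtx e) b := fun R i =>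
      (Sig.Str.isElem_subst hM.functional hab _ _).1 (hb R i).2
    obtain ⟨u, hu, hu'⟩ := hM.eqn e b hb'
    obtain ⟨v, hv, hA⟩ := wfLhs.sound hM b hb' (holds_noHyps _ _)
    obtain rfl := hu.unique hM.functional hv
    exact ⟨u, (Sig.Str.eval_subst hM.functional hab _ _).2 hu,
      (Sig.Str.eval_subst hM.functional hab _ _).2 hu',
      (Sig.Str.isElem_subst hM.functional hab _ _).2 hA⟩
  | _, _, _, _, _, _, _, .hyp h ht _, ρ, hρ, hH => by
    obtain ⟨u, hu, hA⟩ := ht.sound hM ρ hρ hH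
    obtain ⟨v, hv, hv'⟩ := hH _ _ _ h
    obtain rfl := hu.unique hM.functional hv
    exact ⟨u, hu, hv', hA⟩

end

end PreGAT

namespace Sig

variable {G : Sig.{u}} {X Y : G.Srt → Type u}

theorem unarySub_subst (σ : G.Sub X Y) {S : G.Srt} (A : G.Ty X S) (t : G.Tm X S) :
    (fun R x => (unarySub A t R x).subst σ) = unarySub (A.subst σ) (t.subst σ) := by
  funext R x
  cases x <;> rfl

theorem Tm.op_eq_subst (f : G.Op) (a : G.Sub (G.Arg f) X) :
    Tm.op f a = (Tm.op f (G.idSub _)).subst a :=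
  rfl

theorem unarySub_par_main (S : G.Srt) :
    unarySub (G := G) (fun _ j => .var (.par j)) (.var .main) = G.idSub (UVar G.Par S) := by
  funext R x
  cases x <;> rfl

end Sig

namespace UnaryExt

open Sig.Str (EvalSub)

variable {T : PreGAT.{u}} (I : UnaryExt T) {X Y Z : T.Srt → Type u}

theorem subst_base (σ : T.Sub X Y) {S : T.Srt} (t : T.Tm X S) :
    (t.subst σ).subst (fun _ y => .var (.base y)) =
      (t.subst (fun _ x => .var (.base x))).subst (I.dSub σ) := by
  rw [Sig.Tm.subst_subst, Sig.Tm.subst_subst]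
  rfl

theorem Ty_subst_base (σ : T.Sub X Y) {S : T.Srt} (A : T.Ty X S) :
    (A.subst σ).subst (fun _ y => .var (.base y)) =
      (A.subst (fun _ x => .var (.base x))).subst (I.dSub σ) :=
  funext fun _ => funext fun _ => I.subst_base _ _

theorem star_op (c : T.Op) (a : T.Sub (T.Arg c) X) (o : I.O (T.res c)) :
    I.star (.op c a) o = (I.recTm c o).subst (I.dSub a) :=
  rfl

theorem star_subst (σ : T.Sub X Y) {S : T.Srt} (t : T.Tm X S) :
    ∀ o, I.star (t.subst σ) o = (I.star t o).subst (I.dSub σ) := by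
  induction t with
  | var x => exact fun o => rfl
  | op c a ih =>
    intro o
    simp only [Sig.Tm.subst, star_op, Sig.Tm.subst_subst]
    congr 1
    funext R x
    cases x with
    | base x => exact I.subst_base σ (a _ x)
    | star o x => exact ih _ x o

theorem dSub_comp (σ : T.Sub Y Z) (τ : T.Sub X Y) :
    (fun R x => (I.dSub τ R x).subst (I.dSub σ)) = I.dSub (fun _ x => (τ _ x).subst σ) := by
  funext R x
  cases x with
  | base x => exact (I.subst_base σ _).symm
  | star o x => exact (I.star_subst σ _ o).symm

theorem dSub_id : I.dSub (T.idSub X) = T.idSub (I.D X) := by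
  funext R x
  cases x <;> rfl

theorem dSub_unarySub_subst (σ : T.Sub X Y) {S : T.Srt} (A : T.Ty X S) (t : T.Tm X S) :
    (fun R x => (I.dSub (Sig.unarySub A t) R x).subst (I.dSub σ)) =
      I.dSub (Sig.unarySub (A.subst σ) (t.subst σ)) := by
  rw [dSub_comp, Sig.unarySub_subst]

theorem starTy_subst (σ : T.Sub X Y) {S : T.Srt} (o : I.O S) (A : T.Ty X S) (t : T.Tm X S) :
    I.starTy o (A.subst σ) (t.subst σ) = (I.starTy o A t).subst (I.dSub σ) := by
  rw [starTy, starTy, Sig.Ty.subst_subst, dSub_unarySub_subst]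

theorem starTy_main {S : T.Srt} (o : I.O S) :
    I.starTy o (fun _ j => .var (.par j)) (.var .main) = I.cod o := by
  rw [starTy, Sig.unarySub_par_main, dSub_id, Sig.Ty.subst_id]

theorem star_op_id (c : T.Op) (o : I.O (T.res c)) :
    I.star (.op c (T.idSub _)) o = I.recTm c o := by
  rw [star_op, dSub_id, Sig.Tm.subst_id]

/-! ### Environments for the variables `x` and `o(x)` -/

section Env

variable {I} {El : T.Srt → Type u}

/-- The values for the parameters and for the `o(x)`, for `x` a parameter. -/
def parPart {S : T.Srt} (v : ∀ R, I.D (UVar T.Par S) R → El R) : ∀ R, I.D (T.Par S) R → El R :=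
  DVar.elim (fun _ j => v _ (.base (.par j))) (fun _ o j => v _ (.star o (.par j)))

/-- The extension of values for the parameters by values for the main variable. -/
def extend {S : T.Srt} (p : ∀ R, I.D (T.Par S) R → El R) (u : El S)
    (s : ∀ o : I.O S, El (I.out S o)) : ∀ R, I.D (UVar T.Par S) R → El R
  | _, .base (.par j) => p _ (.base j)
  | _, .base .main => u
  | _, .star o (.par j) => p _ (.star o j)
  | _, .star o .main => s o

theorem parPart_extend {S : T.Srt} (p : ∀ R, I.D (T.Par S) R → El R) (u : El S)
    (s : ∀ o : I.O S, El (I.out S o)) : parPart (extend p u s) = p := by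
  funext R x
  cases x <;> rfl

theorem dEnv_ext {S : T.Srt} {v w : ∀ R, I.D (UVar T.Par S) R → El R}
    (hpar : parPart v = parPart w) (hmain : v _ (.base .main) = w _ (.base .main))
    (hstar : ∀ o, v _ (.star o .main) = w _ (.star o .main)) : v = w := by
  funext R x
  match R, x with
  | _, .base (.par j) => exact congrFun (congrFun hpar _) (.base j)
  | _, .base .main => exact hmain
  | _, .star o (.par j) => exact congrFun (congrFun hpar _) (.star o j)
  | _, .star o .main => exact hstar o

variable {M : T.Str}

theorem evalSub_base (ρ : ∀ R, I.D X R → M.El R) :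
    M.EvalSub ρ (fun _ x => .var (.base x)) (fun _ x => ρ _ (.base x)) :=
  fun _ _ => rfl

theorem evalSub_dSub_par {S : T.Srt} (v : ∀ R, I.D (UVar T.Par S) R → M.El R) :
    M.EvalSub v (I.dSub (fun _ j => .var (.par j))) (parPart v) := by
  intro R x
  cases x <;> rfl

theorem evalSub_unary {ρ : ∀ R, I.D X R → M.El R} {S : T.Srt} {A : T.Ty X S} {t : T.Tm X S}
    {w : ∀ R, I.D (UVar T.Par S) R → M.El R} :
    M.EvalSub ρ (I.dSub (Sig.unarySub A t)) w ↔
      M.EvalSub ρ (I.dSub A) (parPart w) ∧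
      M.Eval ρ (t.subst (fun _ x => .var (.base x))) (w _ (.base .main)) ∧
      ∀ o, M.Eval ρ (I.star t o) (w _ (.star o .main)) := by
  constructor
  · intro h
    refine ⟨fun R x => ?_, h _ (.base .main), fun o => h _ (.star o .main)⟩
    cases x with
    | base j => exact h _ (.base (.par j))
    | star o j => exact h _ (.star o (.par j))
  · rintro ⟨h, h', h''⟩ R x
    match R, x with
    | _, .base (.par j) => exact h _ (.base j)
    | _, .base .main => exact h'
    | _, .star o (.par j) => exact h _ (.star o j)
    | _, .star o .main => exact h'' o

theorem evalSub_unary_subst (hM : M.Functional) {ρ : ∀ R, I.D Y R → M.El R} {σ : T.Sub X Y}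
    {v : ∀ R, I.D X R → M.El R} (h : M.EvalSub ρ (I.dSub σ) v) {S : T.Srt} {A : T.Ty X S}
    {t : T.Tm X S} {w : ∀ R, I.D (UVar T.Par S) R → M.El R} :
    M.EvalSub ρ (I.dSub (Sig.unarySub (A.subst σ) (t.subst σ))) w ↔
      M.EvalSub v (I.dSub (Sig.unarySub A t)) w := by
  rw [← dSub_unarySub_subst]
  exact Sig.Str.evalSub_subst hM h _ _

theorem isElem_base (hM : M.Functional) {ρ : ∀ R, I.D X R → M.El R} {S : T.Srt} {A : T.Ty X S}
    {u : M.El S} : M.IsElem ρ (A.subst (fun _ x => .var (.base x))) u ↔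
      M.IsElem (fun _ x => ρ _ (.base x)) A u :=
  Sig.Str.isElem_subst hM (evalSub_base ρ) _ _

theorem isEnv_base (hM : M.Functional) {Γ : T.Ctx X} {ρ : ∀ R, I.D X R → M.El R}
    (h : M.IsEnv (I.dCtx Γ) ρ) : M.IsEnv Γ (fun _ x => ρ _ (.base x)) :=
  fun _ x => (isElem_base hM).1 (h _ (.base x))

theorem isElem_cod {S : T.Srt} {w : ∀ R, I.D (UVar T.Par S) R → M.El R}
    (hw : M.IsEnv (I.dCtx (T.unaryCtx S)) w) (o : I.O S) :
    M.IsElem w (I.cod o) (w _ (.star o .main)) := by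
  have h : M.IsElem w (I.starTy o (fun _ j => .var (.par j)) (.var .main)) _ :=
    hw _ (.star o .main)
  rwa [starTy_main] at h

theorem idx_main {S : T.Srt} {w : ∀ R, I.D (UVar T.Par S) R → M.El R}
    (hw : M.IsEnv (I.dCtx (T.unaryCtx S)) w) {R : T.Srt} (j : T.Par S R) :
    M.idx (w _ (.base .main)) R j = w _ (.base (.par j)) :=
  Eq.symm (hw _ (.base .main) R j)

theorem isEnv_parPart (hM : M.Functional) {S : T.Srt}
    {w : ∀ R, I.D (UVar T.Par S) R → M.El R} :
    M.IsEnv (I.dCtx (T.parCtx S)) (parPart w) ↔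
      ∀ R (j : T.Par S R), M.IsElem w (I.dCtx (T.unaryCtx S) _ (.base (.par j)))
          (w _ (.base (.par j))) ∧
        ∀ o, M.IsElem w (I.dCtx (T.unaryCtx S) _ (.star o (.par j))) (w _ (.star o (.par j))) := by
  have hb {R} (j : T.Par S R) (u) : M.IsElem w (I.dCtx (T.unaryCtx S) _ (.base (.par j))) u ↔
      M.IsElem (parPart w) (I.dCtx (T.parCtx S) _ (.base j)) u := by
    rw [← Sig.Str.isElem_subst hM (evalSub_dSub_par w)]
    change M.IsElem w (((T.parCtx S R j).subst _).subst _) u ↔ _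
    rw [I.Ty_subst_base]
    rfl
  have hs {R} (j : T.Par S R) (o : I.O R) (u) :
      M.IsElem w (I.dCtx (T.unaryCtx S) _ (.star o (.par j))) u ↔
        M.IsElem (parPart w) (I.dCtx (T.parCtx S) _ (.star o j)) u := by
    rw [← Sig.Str.isElem_subst hM (evalSub_dSub_par w)]
    change M.IsElem w (I.starTy o ((T.parCtx S R j).subst _)
      (Sig.Tm.subst (fun _ j => .var (.par j)) (.var j))) u ↔ _
    rw [I.starTy_subst]
    rfl
  constructor
  · exact fun h R j => ⟨(hb j _).2 (h _ (.base j)), fun o => (hs j o _).2 (h _ (.star o j))⟩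
  · intro h R x
    match R, x with
    | _, .base j => exact (hb j _).1 (h _ j).1
    | _, .star o j => exact (hs j o _).1 ((h _ j).2 o)

theorem isEnv_parPart_of_isEnv (hM : M.Functional) {S : T.Srt}
    {w : ∀ R, I.D (UVar T.Par S) R → M.El R} (hw : M.IsEnv (I.dCtx (T.unaryCtx S)) w) :
    M.IsEnv (I.dCtx (T.parCtx S)) (parPart w) :=
  (isEnv_parPart hM).2 fun _ j => ⟨hw _ (.base (.par j)), fun o => hw _ (.star o (.par j))⟩

theorem isEnv_of_unary (hM : M.Functional) {Γ : T.Ctx X} {v : ∀ R, I.D X R → M.El R}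
    (h : ∀ S x, ∃ w, M.EvalSub v (I.dSub (Sig.unarySub (Γ S x) (.var x))) w ∧
      M.IsEnv (I.dCtx (T.unaryCtx S)) w) : M.IsEnv (I.dCtx Γ) v := by
  intro R x
  match R, x with
  | R, .base x =>
    obtain ⟨w, hw, hw'⟩ := h _ x
    obtain e : v _ (.base x) = _ := hw _ (.base .main)
    intro R' j
    rw [e, idx_main hw']
    exact hw _ (.base (.par j))
  | _, .star o x =>
    obtain ⟨w, hw, hw'⟩ := h _ x
    obtain e : v _ (.star o x) = _ := hw _ (.star o .main)
    rw [e]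
    exact (Sig.Str.isElem_subst hM hw _ _).2 (isElem_cod hw' o)

theorem exists_isEnv_of_unary (hM : M.Functional) {Γ : T.Ctx X} {σ : T.Sub X Y}
    {ρ : ∀ R, I.D Y R → M.El R}
    (h : ∀ S x, ∃ w, M.EvalSub ρ (I.dSub (Sig.unarySub ((Γ S x).subst σ) (σ S x))) w ∧
      M.IsEnv (I.dCtx (T.unaryCtx S)) w) :
    ∃ v, M.EvalSub ρ (I.dSub σ) v ∧ M.IsEnv (I.dCtx Γ) v := by
  choose w hw hw' using h
  have hv : M.EvalSub ρ (I.dSub σ) (DVar.elim (fun _ x => w _ x _ (.base .main))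
      (fun _ o x => w _ x _ (.star o .main))) := by
    intro R x
    cases x with
    | base x => exact hw _ x _ (.base .main)
    | star o x => exact hw _ x _ (.star o .main)
  exact ⟨_, hv, isEnv_of_unary hM fun S x => ⟨_, (evalSub_unary_subst hM hv).1 (hw S x), hw' S x⟩⟩

theorem extend_spec (hM : M.Functional) {ρ : ∀ R, I.D X R → M.El R} {S : T.Srt} {A : T.Ty X S}
    {t : T.Tm X S} {p : ∀ R, I.D (T.Par S) R → M.El R} {u : M.El S}
    {s : ∀ o : I.O S, M.El (I.out S o)} (hp : M.EvalSub ρ (I.dSub A) p)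
    (hp' : M.IsEnv (I.dCtx (T.parCtx S)) p)
    (hu : M.Eval ρ (t.subst (fun _ x => .var (.base x))) u)
    (hu' : M.IsElem ρ (A.subst (fun _ x => .var (.base x))) u)
    (hs : ∀ o, M.Eval ρ (I.star t o) (s o)) (hs' : ∀ o, M.IsElem ρ (I.starTy o A t) (s o)) :
    M.EvalSub ρ (I.dSub (Sig.unarySub A t)) (extend p u s) ∧
      M.IsEnv (I.dCtx (T.unaryCtx S)) (extend p u s) := by
  have h : M.EvalSub ρ (I.dSub (Sig.unarySub A t)) (extend p u s) :=
    evalSub_unary.2 ⟨by rwa [parPart_extend], hu, hs⟩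
  have hpar := (isEnv_parPart hM (w := extend p u s)).1 (by rwa [parPart_extend])
  refine ⟨h, fun R x => ?_⟩
  match R, x with
  | _, .base (.par j) => exact (hpar _ j).1
  | _, .base .main => exact fun R j => (hp _ (.base j)).unique hM (hu' R j)
  | _, .star o (.par j) => exact (hpar _ j).2 o
  | _, .star o .main =>
    change M.IsElem _ (I.starTy o (X := UVar T.Par S) (fun _ j => .var (.par j)) (.var .main)) _
    rw [starTy_main]
    exact (Sig.Str.isElem_subst hM h _ _).1 (hs' o)

theorem extend_var_spec (hM : M.Functional) {Γ : T.Ctx X} {ρ : ∀ R, I.D X R → M.El R}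
    (hρ : M.IsEnv (I.dCtx Γ) ρ) {S : T.Srt} (x : X S) {p : ∀ R, I.D (T.Par S) R → M.El R}
    (hp : M.EvalSub ρ (I.dSub (Γ S x)) p) (hp' : M.IsEnv (I.dCtx (T.parCtx S)) p) :
    M.EvalSub ρ (I.dSub (Sig.unarySub (Γ S x) (.var x)))
        (extend p (ρ _ (.base x)) fun o => ρ _ (.star o x)) ∧
      M.IsEnv (I.dCtx (T.unaryCtx S)) (extend p (ρ _ (.base x)) fun o => ρ _ (.star o x)) :=
  extend_spec hM hp hp' rfl (hρ _ (.base x)) (fun _ => rfl) fun o => hρ _ (.star o x)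

end Env

/-! ### Soundness for the variables `x` and `o(x)` -/

/-- The operations in `O` are defined recursively. -/
structure IsRecursive : Prop where
  hasTy_rec : ∀ (c : T.Op) (o : I.O (T.res c)),
    T.HasTy (I.dCtx (T.argCtx c)) (T.noHyps _) (I.recTm c o)
      (I.starTy o (T.resTy c) (.op c (T.idSub _)))
  star_eq : ∀ (e : T.Eqn) (o : I.O (T.eqSrt e)),
    T.EqTm (I.dCtx (T.eqCtx e)) (T.noHyps _) (I.star (T.lhs e) o) (I.star (T.rhs e) o)
      (I.starTy o (T.eqTy e) (T.lhs e))

variable {I} {M : T.Str}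

theorem IsRecursive.exists_op (hI : I.IsRecursive) (hM : T.IsModel M) {f : T.Op}
    {p : ∀ R, I.D (T.Arg f) R → M.El R} (hp : M.IsEnv (I.dCtx (T.argCtx f)) p)
    {q : ∀ R, I.D (T.Par (T.res f)) R → M.El R} (hq : M.EvalSub p (I.dSub (T.resTy f)) q)
    (hq' : M.IsEnv (I.dCtx (T.parCtx (T.res f))) q) :
    ∃ w, M.EvalSub p (I.dSub (Sig.unarySub (T.resTy f) (.op f (T.idSub _)))) w ∧
      M.IsEnv (I.dCtx (T.unaryCtx (T.res f))) w := by
  obtain ⟨u, hu⟩ := (hM.app_iff f _).2 (isEnv_base hM.functional hp)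
  choose s hs hs' using fun o => (hI.hasTy_rec f o).sound hM p hp (PreGAT.holds_noHyps _ _)
  exact ⟨_, extend_spec hM.functional hq hq' ⟨_, fun _ _ => rfl, hu⟩
    ((isElem_base hM.functional).2 (hM.app_elem f _ _ hu)) (fun o => by rw [star_op_id]; exact hs o)
    hs'⟩

theorem IsRecursive.evalSub_rhs (hI : I.IsRecursive) (hM : T.IsModel M) {e : T.Eqn}
    {p : ∀ R, I.D (T.EqVar e) R → M.El R} (hp : M.IsEnv (I.dCtx (T.eqCtx e)) p)
    {w : ∀ R, I.D (UVar T.Par (T.eqSrt e)) R → M.El R}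
    (hw : M.EvalSub p (I.dSub (Sig.unarySub (T.eqTy e) (T.lhs e))) w) :
    M.EvalSub p (I.dSub (Sig.unarySub (T.eqTy e) (T.rhs e))) w := by
  obtain ⟨h, h', h''⟩ := evalSub_unary.1 hw
  refine evalSub_unary.2 ⟨h, ?_, fun o => ?_⟩
  · obtain ⟨u, hu, hu'⟩ := hM.eqn e _ (isEnv_base hM.functional hp)
    rw [Sig.Str.eval_subst hM.functional (evalSub_base p)] at h' ⊢
    exact hu.unique hM.functional h' ▸ hu'
  · obtain ⟨u, hu, hu', -⟩ := (hI.star_eq e o).sound hM p hp (PreGAT.holds_noHyps _ _)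
    exact hu.unique hM.functional (h'' o) ▸ hu'

mutual

theorem IsRecursive.isTy (hI : I.IsRecursive) (hM : T.IsModel M) :
    ∀ {X : T.Srt → Type u} {Γ : T.Ctx X} {H : T.Hyps X} {S : T.Srt} {A : T.Ty X S},
    T.IsTy Γ H A → (∀ S t t₁, ¬ H S t t₁) → ∀ ρ, M.IsEnv (I.dCtx Γ) ρ →
    ∃ p, M.EvalSub ρ (I.dSub A) p ∧ M.IsEnv (I.dCtx (T.parCtx S)) p
  | _, _, _, _, _, .sort _ _ hA, hH, ρ, hρ =>
    exists_isEnv_of_unary hM.functional fun R j => hI.hasTy hM (hA R j) hH ρ hρ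

theorem IsRecursive.hasTy (hI : I.IsRecursive) (hM : T.IsModel M) :
    ∀ {X : T.Srt → Type u} {Γ : T.Ctx X} {H : T.Hyps X} {S : T.Srt} {t : T.Tm X S} {A : T.Ty X S},
    T.HasTy Γ H t A → (∀ S t t₁, ¬ H S t t₁) → ∀ ρ, M.IsEnv (I.dCtx Γ) ρ →
    ∃ w, M.EvalSub ρ (I.dSub (Sig.unarySub A t)) w ∧ M.IsEnv (I.dCtx (T.unaryCtx S)) w
  | _, Γ, _, S, _, .(Γ S x), .var x hx, hH, ρ, hρ => by
    obtain ⟨p, hp, hp'⟩ := hI.isTy hM hx hH ρ hρ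
    exact ⟨_, extend_var_spec hM.functional hρ x hp hp'⟩
  | _, _, _, _, _, _, .op f a _ wfRes ha, hH, ρ, hρ => by
    obtain ⟨p, hp, hp'⟩ :=
      exists_isEnv_of_unary hM.functional fun R i => hI.hasTy hM (ha R i) hH ρ hρ
    obtain ⟨q, hq, hq'⟩ := hI.isTy hM wfRes (fun _ _ _ h => h) p hp'
    obtain ⟨w, hw, hw'⟩ := hI.exists_op hM hp' hq hq'
    exact ⟨w, (evalSub_unary_subst hM.functional hp).2 hw, hw'⟩
  | _, _, _, _, _, _, .conv ht hAB, hH, ρ, hρ => by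
    obtain ⟨w, hw, hw'⟩ := hI.hasTy hM ht hH ρ hρ
    obtain ⟨h, h'⟩ := evalSub_unary.1 hw
    exact ⟨w, evalSub_unary.2 ⟨(hI.eqTy hM hAB hH ρ hρ _).1 h, h'⟩, hw'⟩

theorem IsRecursive.eqTy (hI : I.IsRecursive) (hM : T.IsModel M) :
    ∀ {X : T.Srt → Type u} {Γ : T.Ctx X} {H : T.Hyps X} {S : T.Srt} {A B : T.Ty X S},
    T.EqTy Γ H A B → (∀ S t t₁, ¬ H S t t₁) → ∀ ρ, M.IsEnv (I.dCtx Γ) ρ →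
    ∀ p, M.EvalSub ρ (I.dSub A) p ↔ M.EvalSub ρ (I.dSub B) p
  | _, _, _, _, _, _, .refl _, _, _, _ => fun _ => Iff.rfl
  | _, _, _, _, _, _, .symm h, hH, ρ, hρ => fun p => (hI.eqTy hM h hH ρ hρ p).symm
  | _, _, _, _, _, _, .trans h h', hH, ρ, hρ => fun p =>
    (hI.eqTy hM h hH ρ hρ p).trans (hI.eqTy hM h' hH ρ hρ p)
  | _, _, _, _, _, _, .sort _ _ hAB, hH, ρ, hρ => fun p =>
    forall_congr' fun R => forall_congr' fun x => by
      have key {S : T.Srt} {t t₁ : T.Tm (I.D _) S} {v : M.El S} (h : M.Eval ρ t v)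
          (h₁ : M.Eval ρ t₁ v) {u : M.El S} : M.Eval ρ t u ↔ M.Eval ρ t₁ u :=
        ⟨fun h' => h.unique hM.functional h' ▸ h₁, fun h' => h₁.unique hM.functional h' ▸ h⟩
      cases x with
      | base j =>
        obtain ⟨w, hw, hw', -⟩ := hI.eqTm hM (hAB _ j) hH ρ hρ
        exact key (evalSub_unary.1 hw).2.1 (evalSub_unary.1 hw').2.1
      | star o j =>
        obtain ⟨w, hw, hw', -⟩ := hI.eqTm hM (hAB _ j) hH ρ hρ
        exact key ((evalSub_unary.1 hw).2.2 o) ((evalSub_unary.1 hw').2.2 o)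

theorem IsRecursive.eqTm (hI : I.IsRecursive) (hM : T.IsModel M) :
    ∀ {X : T.Srt → Type u} {Γ : T.Ctx X} {H : T.Hyps X} {S : T.Srt} {t t₁ : T.Tm X S}
    {A : T.Ty X S}, T.EqTm Γ H t t₁ A → (∀ S t t₁, ¬ H S t t₁) → ∀ ρ, M.IsEnv (I.dCtx Γ) ρ →
    ∃ w, M.EvalSub ρ (I.dSub (Sig.unarySub A t)) w ∧ M.EvalSub ρ (I.dSub (Sig.unarySub A t₁)) w ∧
      M.IsEnv (I.dCtx (T.unaryCtx S)) w
  | _, _, _, _, _, _, _, .refl ht, hH, ρ, hρ => by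
    obtain ⟨w, hw, hw'⟩ := hI.hasTy hM ht hH ρ hρ
    exact ⟨w, hw, hw, hw'⟩
  | _, _, _, _, _, _, _, .symm h, hH, ρ, hρ => by
    obtain ⟨w, hw, hw', hw''⟩ := hI.eqTm hM h hH ρ hρ
    exact ⟨w, hw', hw, hw''⟩
  | _, _, _, _, _, _, _, .trans h h₁, hH, ρ, hρ => by
    obtain ⟨w, hw, hw', hw''⟩ := hI.eqTm hM h hH ρ hρ
    obtain ⟨v, hv, hv', -⟩ := hI.eqTm hM h₁ hH ρ hρ
    exact ⟨w, hw, hw'.unique hM.functional hv ▸ hv', hw''⟩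
  | _, _, _, _, _, _, _, .conv h hAB, hH, ρ, hρ => by
    obtain ⟨w, hw, hw', hw''⟩ := hI.eqTm hM h hH ρ hρ
    have hAB := hI.eqTy hM hAB hH ρ hρ (parPart w)
    exact ⟨w, evalSub_unary.2 ⟨hAB.1 (evalSub_unary.1 hw).1, (evalSub_unary.1 hw).2⟩,
      evalSub_unary.2 ⟨hAB.1 (evalSub_unary.1 hw').1, (evalSub_unary.1 hw').2⟩, hw''⟩
  | _, _, _, _, _, _, _, .congr f a b ha _ hab, hH, ρ, hρ => by
    obtain ⟨w, hw, hw'⟩ := hI.hasTy hM ha hH ρ hρ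
    refine ⟨w, hw, ?_, hw'⟩
    choose v hv hv₁ hv' using fun R i => hI.eqTm hM (hab R i) hH ρ hρ
    obtain ⟨p, hp, -⟩ := exists_isEnv_of_unary hM.functional fun R i => ⟨v R i, hv R i, hv' R i⟩
    have hp₁ : M.EvalSub ρ (I.dSub b) p := by
      intro R x
      cases x with
      | base i =>
        rw [(hp _ (.base i)).unique hM.functional (hv _ i _ (.base .main))]
        exact hv₁ _ i _ (.base .main)
      | star o i =>
        rw [(hp _ (.star o i)).unique hM.functional (hv _ i _ (.star o .main))]
        exact hv₁ _ i _ (.star o .main)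
    obtain ⟨hpar, hmain, hstar⟩ := evalSub_unary.1 hw
    refine evalSub_unary.2 ⟨hpar, ?_, fun o => ?_⟩
    · rw [Sig.Tm.op_eq_subst f b, I.subst_base, Sig.Str.eval_subst hM.functional hp₁]
      rwa [Sig.Tm.op_eq_subst f a, I.subst_base, Sig.Str.eval_subst hM.functional hp] at hmain
    · rw [star_op, Sig.Str.eval_subst hM.functional hp₁]
      exact (Sig.Str.eval_subst hM.functional hp _ _).1 (hstar o)
  | _, _, _, _, _, _, _, .ax e a _ wfLhs _ ha, hH, ρ, hρ => by
    obtain ⟨p, hp, hp'⟩ :=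
      exists_isEnv_of_unary hM.functional fun R i => hI.hasTy hM (ha R i) hH ρ hρ
    obtain ⟨w, hw, hw'⟩ := hI.hasTy hM wfLhs (fun _ _ _ h => h) p hp'
    exact ⟨w, (evalSub_unary_subst hM.functional hp).2 hw,
      (evalSub_unary_subst hM.functional hp).2 (hI.evalSub_rhs hM hp' hw), hw'⟩
  | _, _, _, _, _, _, _, .hyp h _ _, hH, _, _ => (hH _ _ _ h).elim

end

end UnaryExt

namespace UnaryExt

variable {T : PreGAT.{u}} {I : UnaryExt T} {X : T.Srt → Type u}

/-! ### The model of elements `x` with values for the `o(x)` -/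

variable (I) in
/-- Elements of `S` with values for the `o(x)`, for `x` the element or one of its parameters. -/
abbrev DEl (M : T.Str) (S : T.Srt) : Type u :=
  {v : ∀ R, I.D (UVar T.Par S) R → M.El R // M.IsEnv (I.dCtx (T.unaryCtx S)) v}

variable {M : T.Str}

/-- The values of the variables `x` and `o(x)`. -/
def flat (r : ∀ S, X S → I.DEl M S) : ∀ R, I.D X R → M.El R :=
  DVar.elim (fun _ x => (r _ x).1 _ (.base .main)) (fun _ o x => (r _ x).1 _ (.star o .main))

/-- The values for the parameters of each variable are the ones given by its type. -/
def Coherent (Γ : T.Ctx X) (r : ∀ S, X S → I.DEl M S) : Prop :=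
  ∀ S x, M.EvalSub (flat r) (I.dSub (Sig.unarySub (Γ S x) (.var x))) (r S x).1

theorem Coherent.isEnv (hM : T.IsModel M) {Γ : T.Ctx X} {r : ∀ S, X S → I.DEl M S}
    (h : Coherent Γ r) : M.IsEnv (I.dCtx Γ) (flat r) :=
  isEnv_of_unary hM.functional fun S x => ⟨_, h S x, (r S x).2⟩

theorem IsRecursive.exists_idx (hI : I.IsRecursive) (hT : T.WellFormed) (hM : T.IsModel M)
    {S : T.Srt} (v : I.DEl M S) (R : T.Srt) (j : T.Par S R) :
    ∃ w : I.DEl M R,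
      M.EvalSub (parPart v.1) (I.dSub (Sig.unarySub (T.parCtx S R j) (.var j))) w.1 := by
  have hv := isEnv_parPart_of_isEnv hM.functional v.2
  obtain ⟨p, hp, hp'⟩ := hI.isTy hM (hT.par S R j) (fun _ _ _ h => h) _ hv
  obtain ⟨h, h'⟩ := extend_var_spec hM.functional hv j hp hp'
  exact ⟨⟨_, h'⟩, h⟩

/-- The structure of elements `x` with values for the `o(x)`. -/
noncomputable def dStr (hI : I.IsRecursive) (hT : T.WellFormed) (hM : T.IsModel M) : T.Str where
  El := I.DEl M
  idx v R j := (hI.exists_idx hT hM v R j).choose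
  app f a u := Coherent (T.argCtx f) a ∧
    M.EvalSub (flat a) (I.dSub (Sig.unarySub (T.resTy f) (.op f (T.idSub _)))) u.1

variable (hI : I.IsRecursive) (hT : T.WellFormed) (hM : T.IsModel M)

theorem dStr_idx_spec {S : T.Srt} (v : I.DEl M S) (R : T.Srt) (j : T.Par S R) :
    M.EvalSub (parPart v.1) (I.dSub (Sig.unarySub (T.parCtx S R j) (.var j)))
      ((dStr hI hT hM).idx v R j).1 :=
  (hI.exists_idx hT hM v R j).choose_spec

theorem dStr_idx_eq {S : T.Srt} {v : I.DEl M S} {R : T.Srt} {j : T.Par S R} {w : I.DEl M R}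
    (h : M.EvalSub (parPart v.1) (I.dSub (Sig.unarySub (T.parCtx S R j) (.var j))) w.1) :
    (dStr hI hT hM).idx v R j = w :=
  Subtype.ext ((dStr_idx_spec hI hT hM v R j).unique hM.functional h)

theorem flat_idx {S : T.Srt} (v : I.DEl M S) : flat ((dStr hI hT hM).idx v) = parPart v.1 := by
  funext R x
  cases x with
  | base j => exact Eq.symm (dStr_idx_spec hI hT hM v _ j _ (.base .main))
  | star o j => exact Eq.symm (dStr_idx_spec hI hT hM v _ j _ (.star o .main))

theorem coherent_idx {S : T.Srt} (v : I.DEl M S) :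
    Coherent (T.parCtx S) ((dStr hI hT hM).idx v) := by
  intro R j
  rw [flat_idx]
  exact dStr_idx_spec hI hT hM v R j

theorem dStr_app_base {f : T.Op} {a : ∀ R, T.Arg f R → I.DEl M R} {u : I.DEl M (T.res f)}
    (h : (dStr hI hT hM).app f a u) :
    M.app f (fun R i => (a R i).1 _ (.base .main)) (u.1 _ (.base .main)) := by
  obtain ⟨b, hb, hu⟩ := (evalSub_unary.1 h.2).2.1
  have : b = fun R i => (a R i).1 _ (.base .main) := funext fun R => funext fun i => (hb R i).symm
  exact this ▸ hu

theorem dStr_app_star {f : T.Op} {a : ∀ R, T.Arg f R → I.DEl M R} {u : I.DEl M (T.res f)}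
    (h : (dStr hI hT hM).app f a u) (o : I.O (T.res f)) :
    M.Eval (flat a) (I.recTm f o) (u.1 _ (.star o .main)) := by
  have := (evalSub_unary.1 h.2).2.2 o
  rwa [star_op_id] at this

theorem eval_flat {r : ∀ S, X S → I.DEl M S} {S : T.Srt} {t : T.Tm X S} :
    ∀ {v : I.DEl M S}, (dStr hI hT hM).Eval r t v →
      M.Eval (flat r) (t.subst fun _ x => .var (.base x)) (v.1 _ (.base .main)) ∧
      ∀ o, M.Eval (flat r) (I.star t o) (v.1 _ (.star o .main)) := by
  induction t with
  | var x => rintro v rfl; exact ⟨rfl, fun o => rfl⟩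
  | op f a ih =>
    rintro v ⟨b, hb, hv⟩
    refine ⟨⟨_, fun R i => (ih R i (hb R i)).1, dStr_app_base hI hT hM hv⟩, fun o => ?_⟩
    have h : M.EvalSub (flat r) (I.dSub a) (flat b) := by
      intro R x
      cases x with
      | base i => exact (ih _ i (hb _ i)).1
      | star o i => exact (ih _ i (hb _ i)).2 o
    rw [star_op, Sig.Str.eval_subst hM.functional h]
    exact dStr_app_star hI hT hM hv o

theorem exists_eval {X : T.Srt → Type u} {Γ : T.Ctx X} {H : T.Hyps X} {S : T.Srt} {t : T.Tm X S}
    {A : T.Ty X S} (ht : T.HasTy Γ H t A) (hH : ∀ S t t₁, ¬ H S t t₁) (r : ∀ S, X S → I.DEl M S)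
    (hr : Coherent Γ r) : ∃ v, (dStr hI hT hM).Eval r t v ∧
      M.EvalSub (flat r) (I.dSub (Sig.unarySub A t)) v.1 :=
  match ht with
  | .var x _ => ⟨_, rfl, hr _ x⟩
  | .op f a wfArg wfRes ha => by
    choose b hb hb' using fun R i => exists_eval (ha R i) hH r hr
    have h : M.EvalSub (flat r) (I.dSub a) (flat b) := by
      intro R x
      cases x with
      | base i => exact (eval_flat hI hT hM (hb _ i)).1
      | star o i => exact (eval_flat hI hT hM (hb _ i)).2 o
    have hb'' : Coherent (T.argCtx f) b := fun R i =>
      (evalSub_unary_subst hM.functional h).1 (hb' R i)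
    obtain ⟨v, hv, hv'⟩ := hI.hasTy hM (.op f a wfArg wfRes ha) hH _ (hr.isEnv hM)
    exact ⟨⟨v, hv'⟩, ⟨b, hb, hb'', (evalSub_unary_subst hM.functional h).1 hv⟩, hv⟩
  | .conv ht hAB => by
    obtain ⟨v, hv, hv'⟩ := exists_eval ht hH r hr
    have h := hI.eqTy hM hAB hH _ (hr.isEnv hM) (parPart v.1)
    exact ⟨v, hv, evalSub_unary.2 ⟨h.1 (evalSub_unary.1 hv').1, (evalSub_unary.1 hv').2⟩⟩

theorem isElem_dStr {Γ : T.Ctx X} {S : T.Srt} {A : T.Ty X S} (hA : T.IsTy Γ (T.noHyps _) A)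
    {r : ∀ S, X S → I.DEl M S} (hr : Coherent Γ r) {v : I.DEl M S}
    (hv : M.EvalSub (flat r) (I.dSub A) (parPart v.1)) : (dStr hI hT hM).IsElem r A v := by
  obtain ⟨_, _, hA⟩ := hA
  intro R j
  obtain ⟨w, hw, hw'⟩ := exists_eval hI hT hM (hA R j) (fun _ _ _ h => h) r hr
  rwa [dStr_idx_eq hI hT hM (w := w) ((evalSub_unary_subst hM.functional hv).1 hw')]

theorem isEnv_dStr {Γ : T.Ctx X} (hΓ : ∀ S x, T.IsTy Γ (T.noHyps _) (Γ S x))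
    {r : ∀ S, X S → I.DEl M S} : (dStr hI hT hM).IsEnv Γ r ↔ Coherent Γ r := by
  constructor
  · intro h S x
    refine evalSub_unary.2 ⟨?_, rfl, fun o => rfl⟩
    rw [← flat_idx hI hT hM]
    intro R y
    cases y with
    | base j => exact (eval_flat hI hT hM (h S x _ j)).1
    | star o j => exact (eval_flat hI hT hM (h S x _ j)).2 o
  · exact fun h S x => isElem_dStr hI hT hM (hΓ S x) h (evalSub_unary.1 (h S x)).1

theorem isModel_dStr : T.IsModel (dStr hI hT hM) where
  idx_env x := (isEnv_dStr hI hT hM (hT.par _)).2 (coherent_idx hI hT hM x)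
  app_unique f a u v hu hv := Subtype.ext (hu.2.unique hM.functional hv.2)
  app_iff f a := by
    refine Iff.trans ?_ (isEnv_dStr hI hT hM (hT.arg f)).symm
    refine ⟨fun ⟨u, hu⟩ => hu.1, fun h => ?_⟩
    have ha := h.isEnv hM
    obtain ⟨q, hq, hq'⟩ := hI.isTy hM (hT.res f) (fun _ _ _ h => h) _ ha
    obtain ⟨w, hw, hw'⟩ := hI.exists_op hM ha hq hq'
    exact ⟨⟨w, hw'⟩, h, hw⟩
  app_elem f a u hu := isElem_dStr hI hT hM (hT.res f) hu.1 (evalSub_unary.1 hu.2).1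
  eqn e ρ hρ := by
    have hρ := (isEnv_dStr hI hT hM (hT.eqVar e)).1 hρ
    obtain ⟨v, hv, hv'⟩ := exists_eval hI hT hM (hT.lhs e) (fun _ _ _ h => h) ρ hρ
    obtain ⟨w, hw, hw'⟩ := exists_eval hI hT hM (hT.rhs e) (fun _ _ _ h => h) ρ hρ
    obtain rfl : v = w := Subtype.ext
      ((hI.evalSub_rhs hM (hρ.isEnv hM) hv').unique hM.functional hw')
    exact ⟨v, hv, hw⟩

end UnaryExt

/-- The values of the variables of a unary operation, for the value `x` of the main variable. -/
def Sig.Str.unaryEnv {G : Sig.{u}} (M : G.Str) {S : G.Srt} (x : M.El S) :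
    ∀ R, UVar G.Par S R → M.El R
  | _, .par j => M.idx x _ j
  | _, .main => x

theorem Sig.Str.evalSub_unarySub {G : Sig.{u}} {M : G.Str} {X : G.Srt → Type u}
    {ρ : ∀ S, X S → M.El S} {S : G.Srt} {A : G.Ty X S} {t : G.Tm X S} {u : M.El S}
    (hA : M.IsElem ρ A u) (ht : M.Eval ρ t u) :
    M.EvalSub ρ (Sig.unarySub A t) (M.unaryEnv u) := by
  intro R x
  cases x with
  | par j => exact hA _ j
  | main => exact ht

theorem PreGAT.IsModel.isEnv_unaryEnv {T : PreGAT.{u}} {M : T.Str} (hM : T.IsModel M) {S : T.Srt}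
    (x : M.El S) : M.IsEnv (T.unaryCtx S) (M.unaryEnv x) := by
  intro R y
  cases y with
  | par j =>
    have h : M.EvalSub (M.unaryEnv x) (fun _ i => .var (.par i)) (M.idx x) := fun _ _ => rfl
    exact (Sig.Str.isElem_subst hM.functional h _ _).2 (hM.idx_env x _ j)
  | main => exact fun R j => rfl

theorem PreGAT.eq_unaryEnv {T : PreGAT.{u}} {M : T.Str} {S : T.Srt}
    {a : ∀ R, UVar T.Par S R → M.El R} (ha : M.IsEnv (T.unaryCtx S) a) :
    a = M.unaryEnv (a S .main) := by
  funext R y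
  cases y with
  | par j => exact ha _ .main _ j
  | main => rfl

namespace UnaryExt

variable {T : PreGAT.{u}} {I : UnaryExt T} {X Y : T.Srt → Type u}

/-! ### Models of `T, O, E` -/

/-- The values of the variables `x` and `o(x)`, given the operations `o`. -/
def opEnv {El : T.Srt → Type u} (op : ∀ S (o : I.O S), El S → El (I.out S o))
    (ρ : ∀ S, X S → El S) : ∀ R, I.D X R → El R :=
  DVar.elim ρ (fun _ o x => op _ o (ρ _ x))

/-- The operations `op` satisfy the typing rules and the recursive equations. -/
structure IsRecModel (M : T.Str) (op : ∀ S (o : I.O S), M.El S → M.El (I.out S o)) : Prop where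
  cod : ∀ S (o : I.O S) x, M.IsElem (opEnv op (M.unaryEnv x)) (I.cod o) (op S o x)
  eqn : ∀ c a u, M.app c a u → ∀ o, M.Eval (opEnv op a) (I.recTm c o) (op _ o u)

section RecModel

variable {M : T.Str} {op : ∀ S (o : I.O S), M.El S → M.El (I.out S o)}

theorem eval_base_opEnv (hM : T.IsModel M) {ρ : ∀ S, X S → M.El S} {S : T.Srt} {t : T.Tm X S}
    {u : M.El S} (h : M.Eval ρ t u) :
    M.Eval (opEnv op ρ) (t.subst fun _ x => .var (.base x)) u :=
  (Sig.Str.eval_subst hM.functional (evalSub_base _) _ _).2 h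

theorem IsRecModel.eval_star (hM : T.IsModel M) (hop : IsRecModel M op) {ρ : ∀ S, X S → M.El S}
    {S : T.Srt} {t : T.Tm X S} : ∀ {u : M.El S}, M.Eval ρ t u → ∀ o,
      M.Eval (opEnv op ρ) (I.star t o) (op _ o u) := by
  induction t with
  | var x => rintro _ rfl o; rfl
  | op f a ih =>
    rintro u ⟨b, hb, hu⟩ o
    have h : M.EvalSub (opEnv op ρ) (I.dSub a) (opEnv op b) := by
      intro R x
      cases x with
      | base i => exact eval_base_opEnv hM (hb _ i)
      | star o i => exact ih _ i (hb _ i) o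
    rw [star_op, Sig.Str.eval_subst hM.functional h]
    exact hop.eqn f b u hu o

theorem IsRecModel.evalSub_dSub (hM : T.IsModel M) (hop : IsRecModel M op)
    {ρ : ∀ S, Y S → M.El S} {σ : T.Sub X Y} {v : ∀ S, X S → M.El S} (h : M.EvalSub ρ σ v) :
    M.EvalSub (opEnv op ρ) (I.dSub σ) (opEnv op v) := by
  intro R x
  cases x with
  | base x => exact eval_base_opEnv hM (h _ x)
  | star o x => exact hop.eval_star hM (h _ x) o

theorem IsRecModel.isEnv_opEnv (hM : T.IsModel M) (hop : IsRecModel M op) {Γ : T.Ctx X}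
    {ρ : ∀ S, X S → M.El S} (h : M.IsEnv Γ ρ) : M.IsEnv (I.dCtx Γ) (opEnv op ρ) := by
  intro R x
  cases x with
  | base x => exact (isElem_base hM.functional).2 (h _ x)
  | star o x =>
    exact (Sig.Str.isElem_subst hM.functional
      (hop.evalSub_dSub hM (Sig.Str.evalSub_unarySub (t := .var x) (h _ x) rfl)) _ _).2 (hop.cod _ o _)

/-! ### The map to the model of elements with values for the `o(x)` -/

variable {N : T.Str}

/-- A map sends `x` to its image, with values for the `o(x)` the images of the `o(x)`. -/
def sharp (hM : T.IsModel M) (hop : IsRecModel M op) (g : ∀ S, M.El S → N.El S)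
    (hidx : ∀ S (x : M.El S) R (j : T.Par S R), g R (M.idx x R j) = N.idx (g S x) R j)
    (happ : ∀ f a u, M.app f a u → N.app f (fun R i => g R (a R i)) (g _ u))
    (S : T.Srt) (x : M.El S) : I.DEl N S :=
  ⟨fun R y => g R (opEnv op (M.unaryEnv x) R y), fun _ y =>
    (hop.isEnv_opEnv hM (hM.isEnv_unaryEnv x) _ y).map g happ hidx⟩

variable (hM : T.IsModel M) (hop : IsRecModel M op) (g : ∀ S, M.El S → N.El S)
  (hidx : ∀ S (x : M.El S) R (j : T.Par S R), g R (M.idx x R j) = N.idx (g S x) R j)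
  (happ : ∀ f a u, M.app f a u → N.app f (fun R i => g R (a R i)) (g _ u))

theorem parPart_sharp {S : T.Srt} (x : M.El S) :
    parPart (sharp hM hop g hidx happ S x).1 = fun R y => g R (opEnv op (M.idx x) R y) := by
  funext R y
  cases y <;> rfl

theorem flat_sharp (ρ : ∀ S, X S → M.El S) :
    flat (fun S x => sharp hM hop g hidx happ S (ρ S x)) = fun R y => g R (opEnv op ρ R y) := by
  funext R y
  cases y <;> rfl

theorem evalSub_sharp {ρ : ∀ S, X S → M.El S} {S : T.Srt} {A : T.Ty X S} {t : T.Tm X S}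
    {u : M.El S} (hA : M.IsElem ρ A u) (ht : M.Eval ρ t u) :
    N.EvalSub (fun R y => g R (opEnv op ρ R y)) (I.dSub (Sig.unarySub A t))
      (sharp hM hop g hidx happ S u).1 :=
  fun R y => (hop.evalSub_dSub hM (Sig.Str.evalSub_unarySub hA ht) R y).map g happ

variable (hI : I.IsRecursive) (hT : T.WellFormed) (hN : T.IsModel N)

theorem sharp_idx {S : T.Srt} (x : M.El S) (R : T.Srt) (j : T.Par S R) :
    sharp hM hop g hidx happ R (M.idx x R j) =
      (dStr hI hT hN).idx (sharp hM hop g hidx happ S x) R j := by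
  refine Eq.symm (dStr_idx_eq hI hT hN ?_)
  rw [parPart_sharp]
  exact evalSub_sharp hM hop g hidx happ (hM.idx_env x _ j) rfl

theorem sharp_app {f : T.Op} {a : ∀ R, T.Arg f R → M.El R} {u : M.El (T.res f)}
    (h : M.app f a u) : (dStr hI hT hN).app f
      (fun R i => sharp hM hop g hidx happ R (a R i)) (sharp hM hop g hidx happ _ u) := by
  have ha := (hM.app_iff f a).1 ⟨u, h⟩
  refine ⟨fun R i => ?_, ?_⟩
  · rw [flat_sharp]
    exact evalSub_sharp hM hop g hidx happ (ha R i) rfl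
  · rw [flat_sharp]
    exact evalSub_sharp hM hop g hidx happ (hM.app_elem f a u h) ⟨a, fun _ _ => rfl, h⟩

end RecModel

/-! ### Comparison with the models of the theory `T, O, E` -/

/-- The structure for the signature of `T, O, E` with the given operations. -/
def recStr (M : T.Str) (op : ∀ S (o : I.O S), M.El S → M.El (I.out S o)) : I.sig.Str where
  El := M.El
  idx := M.idx
  app
    | .inl f => M.app f
    | .inr p => fun a u => ∃ x, a = M.unaryEnv x ∧ u = op p.1 p.2 x

section Unstar

variable {N : I.sig.Str} {op : ∀ S (o : I.O S), N.El S → N.El (I.out S o)}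

theorem unaryEnv_eq_reduct {S : T.Srt} (x : N.El S) :
    N.unaryEnv x = Sig.Str.unaryEnv N.reduct x := by
  funext R y
  cases y <;> rfl

theorem eval_appTm
    (hop : ∀ S (o : I.O S) x, N.app (.inr ⟨S, o⟩) (Sig.Str.unaryEnv N.reduct x) (op S o x))
    {ρ : ∀ S, X S → N.El S} {S : T.Srt} (o : I.O S) {A : I.sig.Ty X S} {t : I.sig.Tm X S}
    {x : N.El S} (hA : N.IsElem ρ A x) (ht : N.Eval ρ t x) :
    N.Eval ρ (I.appTm o A t) (op S o x) :=
  ⟨_, Sig.Str.evalSub_unarySub hA ht, by rw [unaryEnv_eq_reduct]; exact hop S o x⟩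

theorem evalSub_unstar
    (hop : ∀ S (o : I.O S) x, N.app (.inr ⟨S, o⟩) (Sig.Str.unaryEnv N.reduct x) (op S o x))
    {Γ : T.Ctx X} {ρ : ∀ S, X S → N.El S} (h : N.reduct.IsEnv Γ ρ) :
    N.EvalSub ρ (I.unstar Γ) (opEnv op ρ) := by
  intro R x
  cases x with
  | base x => rfl
  | star o x => exact eval_appTm hop o ((N.isElem_lift _ _ _).2 (h _ x)) rfl

end Unstar

theorem IsRecModel.isModel_recStr {M : T.Str} {op : ∀ S (o : I.O S), M.El S → M.El (I.out S o)}
    (hM : T.IsModel M) (hop : IsRecModel M op) : I.recGAT.IsModel (recStr M op) := by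
  have hop' : ∀ S (o : I.O S) x, (recStr M op).app (.inr ⟨S, o⟩)
      (Sig.Str.unaryEnv (recStr M op).reduct x) (op S o x) := fun S o x => ⟨x, rfl, rfl⟩
  have hfun : (recStr M op).Functional := by
    rintro (f | p) a u v hu hv
    · exact hM.app_unique f a u v hu hv
    · obtain ⟨x, rfl, rfl⟩ := hu
      obtain ⟨y, h, rfl⟩ := hv
      obtain rfl : x = y := congrFun (congrFun h _) .main
      rfl
  constructor
  · exact fun x => ((recStr M op).isEnv_lift _ _).2 (hM.idx_env x)
  · exact hfun
  · rintro (f | p) a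
    · exact (hM.app_iff f a).trans ((recStr M op).isEnv_lift _ _).symm
    · refine Iff.trans ?_ ((recStr M op).isEnv_lift _ _).symm
      constructor
      · rintro ⟨_, x, rfl, rfl⟩
        exact hM.isEnv_unaryEnv x
      · exact fun h => ⟨_, a _ .main, PreGAT.eq_unaryEnv h, rfl⟩
  · rintro (f | p) a u hu
    · exact ((recStr M op).isElem_lift _ _ _).2 (hM.app_elem f a u hu)
    · obtain ⟨x, rfl, rfl⟩ := hu
      exact (Sig.Str.isElem_subst hfun (evalSub_unstar hop' (hM.isEnv_unaryEnv x)) _ _).2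
        (((recStr M op).isElem_lift _ _ _).2 (hop.cod _ _ x))
  · rintro (e | ⟨c, o⟩) ρ hρ
    · obtain ⟨u, h, h'⟩ := hM.eqn e ρ (((recStr M op).isEnv_lift _ _).1 hρ)
      exact ⟨u, ((recStr M op).eval_lift _ _ _).2 h, ((recStr M op).eval_lift _ _ _).2 h'⟩
    · have hρ' : M.IsEnv (T.argCtx c) ρ := ((recStr M op).isEnv_lift _ _).1 hρ
      obtain ⟨u, hu⟩ := (hM.app_iff c ρ).2 hρ'
      refine ⟨op _ o u, eval_appTm hop' o
        (((recStr M op).isElem_lift _ _ _).2 (hM.app_elem c ρ u hu)) ?_, ?_⟩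
      · exact ((recStr M op).eval_lift _ _ _).2 ⟨ρ, fun _ _ => rfl, hu⟩
      · exact (Sig.Str.eval_subst hfun (evalSub_unstar hop' hρ') _ _).2
          (((recStr M op).eval_lift _ _ _).2 (hop.eqn c ρ u hu o))

section OfModel

variable {N : I.sig.Str}

theorem exists_op_of_isModel (hN : I.extGAT.IsModel N) (S : T.Srt) (o : I.O S) (x : N.El S) :
    ∃ u, N.app (.inr ⟨S, o⟩) (Sig.Str.unaryEnv N.reduct x) u :=
  (hN.app_iff (.inr ⟨S, o⟩) _).2
    ((N.isEnv_lift _ _).2 ((I.isModel_reduct N hN).isEnv_unaryEnv x))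

variable (hN : I.extGAT.IsModel N)

/-- The unary operations of a model. -/
noncomputable def opOf (S : T.Srt) (o : I.O S) (x : N.El S) : N.El (I.out S o) :=
  (exists_op_of_isModel hN S o x).choose

theorem opOf_spec (S : T.Srt) (o : I.O S) (x : N.El S) :
    N.app (.inr ⟨S, o⟩) (Sig.Str.unaryEnv N.reduct x) (opOf hN S o x) :=
  (exists_op_of_isModel hN S o x).choose_spec

theorem eq_of_app_inr {S : T.Srt} {o : I.O S} {a : ∀ R, UVar T.Par S R → N.El R}
    {u : N.El (I.out S o)} (h : N.app (.inr ⟨S, o⟩) a u) :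
    a = Sig.Str.unaryEnv N.reduct (a S .main) ∧ u = opOf hN S o (a S .main) := by
  have ha : a = Sig.Str.unaryEnv N.reduct (a S .main) :=
    PreGAT.eq_unaryEnv ((N.isEnv_lift _ _).1 ((hN.app_iff (.inr ⟨S, o⟩) a).1 ⟨u, h⟩))
  refine ⟨ha, hN.app_unique (.inr ⟨S, o⟩) _ _ _ h ?_⟩
  have := opOf_spec hN S o (a S .main)
  rwa [← ha] at this

theorem isRecModel_opOf : IsRecModel N.reduct (opOf hN) where
  cod S o x := by
    have h := hN.app_elem (.inr ⟨S, o⟩) _ _ (opOf_spec hN S o x)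
    exact (N.isElem_lift _ _ _).1 ((Sig.Str.isElem_subst hN.functional (evalSub_unstar
      (opOf_spec hN) ((I.isModel_reduct N hN).isEnv_unaryEnv x)) _ _).1 h)
  eqn c a u hu o := by
    have hT := I.isModel_reduct N hN
    have ha := (hT.app_iff c a).1 ⟨u, hu⟩
    obtain ⟨v, h, h'⟩ := hN.eqn (.inl (.inr ⟨c, o⟩)) a ((N.isEnv_lift _ _).2 ha)
    have h'' : N.Eval a (I.appTm o (T.resTy c).lift (Sig.Tm.op c (T.idSub _)).lift)
        (opOf hN _ o u) :=
      eval_appTm (opOf_spec hN) o ((N.isElem_lift _ _ _).2 (hT.app_elem c a u hu))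
        ((N.eval_lift _ _ _).2 ⟨a, fun _ _ => rfl, hu⟩)
    obtain rfl := h.unique hN.functional h''
    exact (N.eval_lift _ _ _).1
      ((Sig.Str.eval_subst hN.functional (evalSub_unstar (opOf_spec hN) ha) _ _).1 h')

end OfModel

end UnaryExt

namespace UnaryExt

variable {T : PreGAT.{u}} {I : UnaryExt T}

/-! ### Hereditary properties -/

section Hereditary

variable {M : T.Str} (op : ∀ S (o : I.O S), M.El S → M.El (I.out S o))
  (P : ∀ S, M.El S → Prop)

/-- `P` holds for an element, and for all elements obtained from it by at most `k` unary
operations. -/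
def HereditaryUpTo : ℕ → ∀ S, M.El S → Prop
  | 0 => P
  | k + 1 => fun S x => P S x ∧ ∀ o : I.O S, HereditaryUpTo k _ (op S o x)

/-- `P` holds for all elements obtained from an element and its parameters by unary operations. -/
def Hereditary (S : T.Srt) (x : M.El S) : Prop :=
  ∀ k, HereditaryUpTo op P k S x ∧ ∀ R j, HereditaryUpTo op P k R (M.idx x R j)

variable {op P}

theorem HereditaryUpTo.pred : ∀ {k : ℕ} {S : T.Srt} {x : M.El S},
    HereditaryUpTo op P (k + 1) S x → HereditaryUpTo op P k S x
  | 0, _, _, h => h.1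
  | _ + 1, _, _, h => ⟨h.1, fun o => (h.2 o).pred⟩

theorem Hereditary.holds {S : T.Srt} {x : M.El S} (h : Hereditary op P S x) : P S x :=
  (h 0).1

theorem Hereditary.of_closed {Q : ∀ S, M.El S → Prop} (hQ : ∀ S x, Q S x → P S x)
    (hidx : ∀ S x, Q S x → ∀ R j, Q R (M.idx x R j))
    (hop : ∀ S x, Q S x → ∀ o, Q _ (op S o x)) {S : T.Srt} {x : M.El S} (h : Q S x) :
    Hereditary op P S x := by
  have key : ∀ k S x, Q S x → HereditaryUpTo op P k S x := by
    intro k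
    induction k with
    | zero => exact hQ
    | succ k ih => exact fun S x h => ⟨hQ S x h, fun o => ih _ _ (hop S x h o)⟩
  exact fun k => ⟨key k S x h, fun R j => key k R _ (hidx S x h R j)⟩

theorem HereditaryUpTo.app
    (hP : ∀ f a u, (∀ R i, P R (a R i)) → M.app f a u → P _ u)
    (heqn : ∀ c a u, (∀ R i, P R (a R i)) → M.app c a u → ∀ o,
      M.Eval (opEnv op a) (I.recTm c o) (op _ o u)) (k : ℕ) :
    ∀ f a u, (∀ R i, HereditaryUpTo op P k R (a R i)) → M.app f a u →
      HereditaryUpTo op P k _ u := by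
  induction k with
  | zero => exact hP
  | succ k ih =>
    intro f a u ha hu
    refine ⟨hP f a u (fun R i => (ha R i).1) hu, fun o => ?_⟩
    refine (heqn f a u (fun R i => (ha R i).1) hu o).closed ih fun R x => ?_
    cases x with
    | base i => exact (ha _ i).pred
    | star o i => exact (ha _ i).2 o

theorem Hereditary.app (hM : T.IsModel M)
    (hP : ∀ f a u, (∀ R i, P R (a R i)) → M.app f a u → P _ u)
    (heqn : ∀ c a u, (∀ R i, P R (a R i)) → M.app c a u → ∀ o,
      M.Eval (opEnv op a) (I.recTm c o) (op _ o u)) :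
    ∀ f a u, (∀ R i, Hereditary op P R (a R i)) → M.app f a u → Hereditary op P _ u := by
  intro f a u ha hu k
  have h := HereditaryUpTo.app hP heqn k
  exact ⟨h f a u (fun R i => (ha R i k).1) hu, fun R j =>
    Sig.Str.Eval.closed h (fun R i => (ha R i k).1) (hM.app_elem f a u hu R j)⟩

theorem Hereditary.idx (hM : T.IsModel M)
    (hP : ∀ f a u, (∀ R i, P R (a R i)) → M.app f a u → P _ u)
    (heqn : ∀ c a u, (∀ R i, P R (a R i)) → M.app c a u → ∀ o,
      M.Eval (opEnv op a) (I.recTm c o) (op _ o u)) :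
    ∀ S x, Hereditary op P S x → ∀ R j, Hereditary op P R (M.idx x R j) := by
  intro S x hx R j k
  exact ⟨(hx k).2 R j, fun R' j' =>
    Sig.Str.Eval.closed (HereditaryUpTo.app hP heqn k) (hx k).2 (hM.idx_env x R j R' j')⟩

theorem Hereditary.apply
    (hP : ∀ f a u, (∀ R i, P R (a R i)) → M.app f a u → P _ u)
    (heqn : ∀ c a u, (∀ R i, P R (a R i)) → M.app c a u → ∀ o,
      M.Eval (opEnv op a) (I.recTm c o) (op _ o u))
    (hcod : ∀ S x, P S x → ∀ o, M.IsElem (opEnv op (M.unaryEnv x)) (I.cod o) (op S o x)) :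
    ∀ S x, Hereditary op P S x → ∀ o, Hereditary op P _ (op S o x) := by
  intro S x hx o k
  refine ⟨(hx (k + 1)).1.2 o, fun R j =>
    Sig.Str.Eval.closed (HereditaryUpTo.app hP heqn k) (fun R y => ?_)
      (hcod S x hx.holds o R j)⟩
  match R, y with
  | _, .base (.par j) => exact (hx k).2 _ j
  | _, .base .main => exact (hx k).1
  | _, .star o (.par j) => exact ((hx (k + 1)).2 _ j).2 o
  | _, .star o .main => exact (hx (k + 1)).1.2 o

end Hereditary

/-! ### The cofree model of `T, O, E` -/

section Cofree

variable (hI : I.IsRecursive) (hT : T.WellFormed) (M : T.Alg)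

/-- The iteration of the construction of the model of elements `x` with values for the `o(x)`. -/
noncomputable def iter : ℕ → T.Alg
  | 0 => M
  | n + 1 => ⟨dStr hI hT (iter n).isModel, isModel_dStr hI hT (iter n).isModel⟩

/-- The product of the iterations. -/
noncomputable def tower : T.Str :=
  Sig.Str.pi fun n => (iter hI hT M n).str

theorem isModel_tower : T.IsModel (tower hI hT M) :=
  PreGAT.IsModel.pi fun n => (iter hI hT M n).isModel

variable {hI hT M}

/-- The components of an element of the product of the iterations. -/
def shift {S : T.Srt} (w : (tower hI hT M).El S) :
    ∀ R, I.D (UVar T.Par S) R → (tower hI hT M).El R :=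
  fun R y n => (w (n + 1) : I.DEl (iter hI hT M n).str S).1 R y

theorem isEnv_shift {S : T.Srt} (w : (tower hI hT M).El S) :
    (tower hI hT M).IsEnv (I.dCtx (T.unaryCtx S)) (shift w) := fun R y R' j =>
  (Sig.Str.eval_pi _ _ _).2 fun n =>
    (w (n + 1) : I.DEl (iter hI hT M n).str S).2 R y R' j

theorem parPart_shift {S : T.Srt} (w : (tower hI hT M).El S) :
    parPart (shift w) = DVar.elim (Z := (tower hI hT M).El)
      (fun _ j => shift ((tower hI hT M).idx w _ j) _ (.base .main))
      (fun _ o j => shift ((tower hI hT M).idx w _ j) _ (.star o .main)) := by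
  have h (n : ℕ) := flat_idx hI hT (iter hI hT M n).isModel (w (n + 1))
  funext R y
  cases y with
  | base j => exact funext fun n => (congrFun (congrFun (h n) _) (.base j)).symm
  | star o j => exact funext fun n => (congrFun (congrFun (h n) _) (.star o j)).symm

theorem shift_app_base {f : T.Op} {a : ∀ R, T.Arg f R → (tower hI hT M).El R}
    {u : (tower hI hT M).El (T.res f)} (h : (tower hI hT M).app f a u) :
    (tower hI hT M).app f (fun R i => shift (a R i) _ (.base .main)) (shift u _ (.base .main)) :=
  fun n => dStr_app_base hI hT (iter hI hT M n).isModel (h (n + 1))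

/-- The unary operations on the product of the iterations. -/
def towerOp (S : T.Srt) (o : I.O S) (w : (tower hI hT M).El S) : (tower hI hT M).El (I.out S o) :=
  shift w _ (.star o .main)

/-- The components of `w` are compatible with the projections. -/
def IsCounital (S : T.Srt) (w : (tower hI hT M).El S) : Prop :=
  shift w _ (.base .main) = w

theorem IsCounital.app (f : T.Op) (a : ∀ R, T.Arg f R → (tower hI hT M).El R)
    (u : (tower hI hT M).El (T.res f)) (ha : ∀ R i, IsCounital R (a R i))
    (h : (tower hI hT M).app f a u) : IsCounital _ u := by
  have h' := shift_app_base h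
  have e : (fun R i => shift (a R i) _ (.base .main)) = a := funext fun R => funext fun i => ha R i
  rw [e] at h'
  exact (isModel_tower hI hT M).app_unique f a _ _ h' h

theorem IsCounital.eval_recTm (c : T.Op) (a : ∀ R, T.Arg c R → (tower hI hT M).El R)
    (u : (tower hI hT M).El (T.res c)) (ha : ∀ R i, IsCounital R (a R i))
    (h : (tower hI hT M).app c a u) (o : I.O (T.res c)) :
    (tower hI hT M).Eval (opEnv towerOp a) (I.recTm c o) (towerOp _ o u) := by
  refine (Sig.Str.eval_pi _ _ _).2 fun n => ?_
  have h' := dStr_app_star hI hT (iter hI hT M n).isModel (h (n + 1)) o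
  have e : flat (fun R i => a R i (n + 1)) = fun R y => opEnv towerOp a R y n := by
    funext R y
    cases y with
    | base i => exact congrFun (ha _ i) n
    | star o i => rfl
  rw [e] at h'
  exact h'

theorem IsCounital.shift_eq {S : T.Srt} {w : (tower hI hT M).El S} (hw : IsCounital S w) :
    shift w = opEnv towerOp ((tower hI hT M).unaryEnv w) := by
  refine dEnv_ext ?_ hw fun o => rfl
  funext R y
  cases y with
  | base j =>
    refine (idx_main (isEnv_shift w) j).symm.trans ?_
    exact congrArg (fun x => (tower hI hT M).idx x _ j) hw
  | star o j => exact congrFun (congrFun (parPart_shift w) _) (.star o j)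

theorem IsCounital.cod (S : T.Srt) (w : (tower hI hT M).El S) (hw : IsCounital S w) (o : I.O S) :
    (tower hI hT M).IsElem (opEnv towerOp ((tower hI hT M).unaryEnv w)) (I.cod o)
      (towerOp S o w) := by
  rw [← hw.shift_eq]
  exact isElem_cod (isEnv_shift w) o

variable (hI hT M)

/-- The model of `T` consisting of the elements of the product of the iterations which are
hereditarily compatible with the projections. -/
noncomputable def cofreeStr : T.Str :=
  (tower hI hT M).sub (Hereditary towerOp IsCounital)
    (Hereditary.idx (isModel_tower hI hT M) IsCounital.app IsCounital.eval_recTm)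

/-- The unary operations of the cofree model. -/
def cofreeOp (S : T.Srt) (o : I.O S) (w : (cofreeStr hI hT M).El S) :
    (cofreeStr hI hT M).El (I.out S o) :=
  ⟨towerOp S o w.1,
    Hereditary.apply IsCounital.app IsCounital.eval_recTm IsCounital.cod S w.1 w.2 o⟩

theorem isModel_cofreeStr : T.IsModel (cofreeStr hI hT M) :=
  (isModel_tower hI hT M).sub _
    (Hereditary.app (isModel_tower hI hT M) IsCounital.app IsCounital.eval_recTm)

theorem eval_cofreeStr {X : T.Srt → Type u} {ρ : ∀ S, X S → (cofreeStr hI hT M).El S} {S : T.Srt}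
    {t : T.Tm X S} {u : (cofreeStr hI hT M).El S} :
    (cofreeStr hI hT M).Eval ρ t u ↔ (tower hI hT M).Eval (fun _ x => (ρ _ x).1) t u.1 :=
  Sig.Str.eval_sub _
    (Hereditary.app (isModel_tower hI hT M) IsCounital.app IsCounital.eval_recTm) _ _ _

theorem isRecModel_cofreeOp : IsRecModel (cofreeStr hI hT M) (cofreeOp hI hT M) where
  cod S o w R j := by
    refine (eval_cofreeStr hI hT M).2 ?_
    have e : (fun R y => (opEnv (cofreeOp hI hT M) ((cofreeStr hI hT M).unaryEnv w) R y).1) =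
        opEnv towerOp ((tower hI hT M).unaryEnv w.1) := dEnv_ext
      (by funext R y; cases y <;> rfl) rfl fun o => rfl
    rw [e]
    exact IsCounital.cod S w.1 w.2.holds o R j
  eqn c a u hu o := by
    refine (eval_cofreeStr hI hT M).2 ?_
    have e : (fun R y => (opEnv (cofreeOp hI hT M) a R y).1) =
        opEnv towerOp (fun R i => (a R i).1) := by funext R y; cases y <;> rfl
    rw [e]
    exact IsCounital.eval_recTm c _ u.1 (fun R i => (a R i).2.holds) hu o

end Cofree

end UnaryExt

theorem Sig.Str.map_unaryEnv {G : Sig.{u}} {N N' : G.Str} (g : ∀ S, N.El S → N'.El S)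
    (hg : ∀ S (x : N.El S) R (j : G.Par S R), g R (N.idx x R j) = N'.idx (g S x) R j)
    {S : G.Srt} (x : N.El S) :
    (fun R y => g R (N.unaryEnv x R y)) = N'.unaryEnv (g S x) := by
  funext R y
  cases y with
  | par j => exact hg S x R j
  | main => rfl

namespace UnaryExt

variable {T : PreGAT.{u}} {I : UnaryExt T}

/-! ### The unary equations -/

/-- The equations in `E'` on the sort `S` hold for `x`. -/
def SatisfiesEqs (N : I.sig.Str) (S : T.Srt) (x : N.El S) : Prop :=
  ∀ e : I.Eqs S, ∃ u, N.Eval (N.unaryEnv x) (I.lhs e) u ∧ N.Eval (N.unaryEnv x) (I.rhs e) u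

variable (I) in
/-- The equations in `E'` are proved inductively. -/
def IsInductive : Prop :=
  ∀ (c : T.Op) (e : I.Eqs (T.res c)),
    I.recGAT.EqTm (X := T.Arg c) (T.argCtx c).lift (I.IndHyps c)
      (Sig.Tm.subst (G := I.sig) (I.conSub c) (I.lhs e))
      (Sig.Tm.subst (G := I.sig) (I.conSub c) (I.rhs e))
      (Sig.Ty.subst (G := I.sig) (I.conSub c) (I.eqTy e))

section Eqs

variable {M : T.Str} {op : ∀ S (o : I.O S), M.El S → M.El (I.out S o)}

theorem SatisfiesEqs.app (hE : I.IsInductive) (hM : T.IsModel M) (hop : IsRecModel M op)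
    (f : T.Op) (a : ∀ R, T.Arg f R → M.El R) (u : M.El (T.res f))
    (ha : ∀ R i, SatisfiesEqs (recStr M op) R (a R i)) (h : M.app f a u) :
    SatisfiesEqs (recStr M op) _ u := by
  intro e
  have hN := hop.isModel_recStr hM
  have ha' := (hM.app_iff f a).1 ⟨u, h⟩
  have hu : (recStr M op).EvalSub a (I.conSub f) ((recStr M op).unaryEnv u) :=
    Sig.Str.evalSub_unarySub
      (((recStr M op).isElem_lift a (T.resTy f) u).2 (hM.app_elem f a u h))
      (((recStr M op).eval_lift a (.op f (T.idSub _)) u).2 ⟨a, fun _ _ => rfl, h⟩)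
  obtain ⟨v, hv, hv', -⟩ := (hE f e).sound hN a (((recStr M op).isEnv_lift _ _).2 ha') (by
    rintro _ _ _ ⟨x, e⟩
    have hx : (recStr M op).EvalSub a
        (Sig.unarySub (G := I.sig) (T.argCtx f _ x).lift (.var (G := I.sig) x))
        ((recStr M op).unaryEnv (a _ x)) :=
      Sig.Str.evalSub_unarySub (((recStr M op).isElem_lift _ _ _).2 (ha' _ x)) rfl
    obtain ⟨v, hv, hv'⟩ := ha _ x e
    exact ⟨v, (Sig.Str.eval_subst hN.functional hx _ _).2 hv,
      (Sig.Str.eval_subst hN.functional hx _ _).2 hv'⟩)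
  exact ⟨v, (Sig.Str.eval_subst hN.functional hu _ _).1 hv,
    (Sig.Str.eval_subst hN.functional hu _ _).1 hv'⟩

/-- The elements of a model of `T, O, E` for which the equations in `E'` hold hereditarily. -/
def eqsStr (hE : I.IsInductive) (hM : T.IsModel M) (hop : IsRecModel M op) : I.sig.Str :=
  (recStr M op).sub (Hereditary op (SatisfiesEqs (recStr M op)))
    (Hereditary.idx hM (SatisfiesEqs.app hE hM hop) fun c a u _ => hop.eqn c a u)

theorem hereditary_app_recStr (hE : I.IsInductive) (hM : T.IsModel M) (hop : IsRecModel M op)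
    (f : I.sig.Op) (a : ∀ R, I.sig.Arg f R → M.El R) (u : M.El (I.sig.res f))
    (ha : ∀ R i, Hereditary op (SatisfiesEqs (recStr M op)) R (a R i))
    (h : (recStr M op).app f a u) : Hereditary op (SatisfiesEqs (recStr M op)) _ u := by
  match f with
  | .inl f =>
    exact Hereditary.app hM (SatisfiesEqs.app hE hM hop) (fun c a u _ => hop.eqn c a u) f a u ha h
  | .inr ⟨S, o⟩ =>
    obtain ⟨x, rfl, rfl⟩ := h
    exact Hereditary.apply (SatisfiesEqs.app hE hM hop) (fun c a u _ => hop.eqn c a u)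
      (fun S x _ o => hop.cod S o x) S x (ha S .main) o

theorem isModel_eqsStr (hE : I.IsInductive) (hM : T.IsModel M) (hop : IsRecModel M op) :
    I.extGAT.IsModel (eqsStr hE hM hop) := by
  have h : I.recGAT.IsModel (eqsStr hE hM hop) :=
    (hop.isModel_recStr hM).sub _ (hereditary_app_recStr hE hM hop)
  constructor
  · exact h.idx_env
  · exact h.app_unique
  · exact h.app_iff
  · exact h.app_elem
  · rintro (e | ⟨S, e⟩) ρ hρ
    · exact h.eqn e ρ hρ
    · have hρ' := PreGAT.eq_unaryEnv (((eqsStr hE hM hop).isEnv_lift _ _).1 hρ)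
      have e' : (fun R y => (ρ R y).1) = (recStr M op).unaryEnv (ρ S .main).1 := by
        funext R y
        rw [hρ']
        cases y <;> rfl
      obtain ⟨u, hu, hu'⟩ := (ρ S .main).2.holds e
      rw [← e'] at hu hu'
      exact ⟨⟨u, hu.closed (hereditary_app_recStr hE hM hop) fun S x => (ρ S x).2⟩,
        (Sig.Str.eval_sub _ (hereditary_app_recStr hE hM hop) _ _ _).2 hu,
        (Sig.Str.eval_sub _ (hereditary_app_recStr hE hM hop) _ _ _).2 hu'⟩

end Eqs

/-! ### The cofree model of `T, O, E, E'` -/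

variable (hI : I.IsRecursive) (hE : I.IsInductive) (hT : T.WellFormed) (M : T.Alg)

/-- The cofree model of `T, O, E, E'`. -/
noncomputable def cofree : I.extGAT.Alg :=
  ⟨_, isModel_eqsStr hE (isModel_cofreeStr hI hT M) (isRecModel_cofreeOp hI hT M)⟩

/-- The underlying model of `T`. -/
def reductAlg (N : I.extGAT.Alg) : T.Alg :=
  ⟨N.str.reduct, I.isModel_reduct N.str N.isModel⟩

/-- The projection of the cofree model to its base. -/
def cofreeCounit : PreGAT.Alg.Hom (reductAlg (cofree hI hE hT M)) M where
  map _ w := w.1.1 0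
  map_idx _ _ _ := rfl
  map_app _ _ _ h := h 0

section Lift

variable {hI hE hT M} {N : I.extGAT.Alg} (g : PreGAT.Alg.Hom (reductAlg N) M)

/-- The components of the map induced by `g` to the cofree model. -/
noncomputable def iterMap : ∀ n, PreGAT.Alg.Hom (reductAlg N) (iter hI hT M n)
  | 0 => g
  | n + 1 =>
    { map := sharp (reductAlg N).isModel (isRecModel_opOf N.isModel) (iterMap n).map
        (fun _ => (iterMap n).map_idx) (iterMap n).map_app
      map_idx := sharp_idx _ _ _ _ _ hI hT (iter hI hT M n).isModel
      map_app := fun _ _ _ => sharp_app _ _ _ _ _ hI hT (iter hI hT M n).isModel }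

/-- The map induced by `g` to the product of the iterations. -/
noncomputable def towerMap (S : T.Srt) (x : N.str.El S) : (tower hI hT M).El S :=
  fun n => (iterMap g n).map S x

theorem towerMap_idx {S : T.Srt} (x : N.str.El S) (R : T.Srt) (j : T.Par S R) :
    towerMap (hI := hI) (hT := hT) g R (N.str.idx x R j) =
      (tower hI hT M).idx (towerMap g S x) R j :=
  funext fun n => (iterMap g n).map_idx x R j

theorem hereditary_towerMap {S : T.Srt} (x : N.str.El S) :
    Hereditary towerOp IsCounital S (towerMap (hI := hI) (hT := hT) g S x) := by
  refine Hereditary.of_closed (Q := fun S w => ∃ x, w = towerMap g S x) ?_ ?_ ?_ ⟨x, rfl⟩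
  · rintro S _ ⟨x, rfl⟩
    rfl
  · rintro S _ ⟨x, rfl⟩ R j
    exact ⟨_, (towerMap_idx g x R j).symm⟩
  · rintro S _ ⟨x, rfl⟩ o
    exact ⟨opOf N.isModel S o x, rfl⟩

/-- The map induced by `g` to the cofree model of `T, O, E`. -/
noncomputable def cofreeMap (S : T.Srt) (x : N.str.El S) : (cofreeStr hI hT M).El S :=
  ⟨towerMap g S x, hereditary_towerMap g x⟩

theorem cofreeMap_idx {S : T.Srt} (x : N.str.El S) (R : T.Srt) (j : T.Par S R) :
    cofreeMap (hI := hI) (hT := hT) g R (N.str.idx x R j) =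
      (cofreeStr hI hT M).idx (cofreeMap g S x) R j :=
  Subtype.ext (towerMap_idx g x R j)

theorem cofreeMap_app (f : I.sig.Op) (a : ∀ R, I.sig.Arg f R → N.str.El R)
    (u : N.str.El (I.sig.res f)) (h : N.str.app f a u) :
    (recStr (cofreeStr hI hT M) (cofreeOp hI hT M)).app f
      (fun R i => cofreeMap g R (a R i)) (cofreeMap g _ u) := by
  match f with
  | .inl f => exact fun n => (iterMap g n).map_app f a u h
  | .inr ⟨S, o⟩ =>
    obtain ⟨ha, hu⟩ := eq_of_app_inr N.isModel h
    refine ⟨cofreeMap g S (a S .main), ?_, ?_⟩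
    · refine Eq.trans ?_ (Sig.Str.map_unaryEnv (N := N.str.reduct) (N' := cofreeStr hI hT M)
        (cofreeMap g) (fun S x R j => cofreeMap_idx g x R j) (a S .main))
      rw [← ha]
    · rw [hu]
      rfl

theorem hereditary_cofreeMap {S : T.Srt} (x : N.str.El S) :
    Hereditary (cofreeOp hI hT M)
      (SatisfiesEqs (recStr (cofreeStr hI hT M) (cofreeOp hI hT M))) S (cofreeMap g S x) := by
  refine Hereditary.of_closed (Q := fun S w => ∃ x, w = cofreeMap g S x) ?_ ?_ ?_ ⟨x, rfl⟩
  · rintro S _ ⟨x, rfl⟩ e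
    have hx := (N.str.isEnv_lift _ _).2 ((reductAlg N).isModel.isEnv_unaryEnv x)
    obtain ⟨u, hu, hu'⟩ := N.isModel.eqn (.inr ⟨S, e⟩) _ hx
    have key := Sig.Str.map_unaryEnv (N := N.str.reduct) (N' := cofreeStr hI hT M) (cofreeMap g)
        (fun S x R j => cofreeMap_idx g x R j) x
    have hv := hu.map (N := recStr (cofreeStr hI hT M) (cofreeOp hI hT M)) _ (cofreeMap_app g)
    have hv' := hu'.map (N := recStr (cofreeStr hI hT M) (cofreeOp hI hT M)) _ (cofreeMap_app g)
    have key' := key.trans (unaryEnv_eq_reduct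
      (N := recStr (cofreeStr hI hT M) (cofreeOp hI hT M)) (cofreeMap g S x)).symm
    exact ⟨_, Eq.mp (congrArg (Sig.Str.Eval _ · (I.lhs e) _) key') hv,
      Eq.mp (congrArg (Sig.Str.Eval _ · (I.rhs e) _) key') hv'⟩
  · rintro S _ ⟨x, rfl⟩ R j
    exact ⟨_, (cofreeMap_idx g x R j).symm⟩
  · rintro S _ ⟨x, rfl⟩ o
    exact ⟨opOf N.isModel S o x, rfl⟩

variable (hE) in
/-- The morphism of models induced by `g` to the cofree model. -/
noncomputable def cofreeLift : PreGAT.Alg.Hom N (cofree hI hE hT M) where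
  map S x := ⟨cofreeMap g S x, hereditary_cofreeMap g x⟩
  map_idx x R j := Subtype.ext (cofreeMap_idx g x R j)
  map_app f a u h := cofreeMap_app g f a u h

end Lift

theorem cofree_hom_ext {N : I.extGAT.Alg} (g h : PreGAT.Alg.Hom N (cofree hI hE hT M))
    (H : ∀ S x, (g.map S x).1.1 0 = (h.map S x).1.1 0) : g = h := by
  have hop (k : PreGAT.Alg.Hom N (cofree hI hE hT M)) (S : T.Srt) (o : I.O S) (x : N.str.El S) :
      (k.map _ (opOf N.isModel S o x)).1.1 = towerOp S o (k.map S x).1.1 := by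
    obtain ⟨y, hy, hy'⟩ := k.map_app (.inr ⟨S, o⟩) _ _ (opOf_spec N.isModel S o x)
    obtain rfl : (k.map S x).1 = y := congrFun (congrFun hy S) .main
    exact congrArg Subtype.val hy'
  have hidx (k : PreGAT.Alg.Hom N (cofree hI hE hT M)) (S : T.Srt) (x : N.str.El S) (R : T.Srt)
      (j : T.Par S R) : (tower hI hT M).idx (k.map S x).1.1 R j =
        (k.map R (N.str.idx x R j)).1.1 :=
    congrArg (fun w => w.1.1) (k.map_idx x R j).symm
  have hshift (k : PreGAT.Alg.Hom N (cofree hI hE hT M)) (S : T.Srt) (x : N.str.El S) :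
      shift (k.map S x).1.1 = fun R y => (k.map R
        (opEnv (opOf N.isModel) (Sig.Str.unaryEnv N.str.reduct x) R y)).1.1 := by
    rw [(k.map S x).1.2.holds.shift_eq]
    funext R y
    match R, y with
    | _, .base (.par j) => exact hidx k S x _ j
    | _, .base .main => rfl
    | _, .star o (.par j) =>
      exact (congrArg (towerOp _ o) (hidx k S x _ j)).trans (hop k _ o _).symm
    | _, .star o .main => exact (hop k S o x).symm
  have key : ∀ n S x, (g.map S x).1.1 n = (h.map S x).1.1 n := by
    intro n
    induction n with
    | zero => exact H
    | succ n ih =>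
      intro S x
      refine Subtype.ext (funext fun R => funext fun y => ?_)
      have hg := congrFun (congrFun (congrFun (hshift g S x) R) y) n
      have hh := congrFun (congrFun (congrFun (hshift h S x) R) y) n
      exact hg.trans ((ih _ _).trans hh.symm)
  refine PreGAT.Alg.Hom.ext (funext fun S => funext fun x => ?_)
  exact Subtype.ext (Subtype.ext (funext fun n => key n S x))

end UnaryExt

theorem mainTheorem1 (T : GAT.{u}) (I : Interpretation T) :
    I.forget.IsLeftAdjoint := by
  have hI : I.toUnaryExt.IsRecursive := ⟨I.hasTy_rec, I.star_eq⟩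
  have (M : T.Alg) : Limits.HasTerminal (CostructuredArrow I.forget M) := by
    refine Limits.IsTerminal.hasTerminal (X := CostructuredArrow.mk
      (Y := (UnaryExt.cofree hI I.induct T.wf M : I.toGAT.Alg))
      (UnaryExt.cofreeCounit hI I.induct T.wf M)) ?_
    refine Limits.IsTerminal.ofUniqueHom
      (fun X => CostructuredArrow.homMk (UnaryExt.cofreeLift I.induct X.hom) rfl) fun X k => ?_
    refine CostructuredArrow.hom_ext _ _ (UnaryExt.cofree_hom_ext hI I.induct T.wf M _ _ ?_)
    intro S x
    exact congrFun (congrFun (congrArg PreGAT.Alg.Hom.map (CostructuredArrow.w k)) S) x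
  exact isLeftAdjoint_of_costructuredArrowTerminals I.forget
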